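/- Setting. Let $\mathfrak H=\mathfrak H_1\oplus\mathfrak H_2$ be an orthogonal sum of complex Hilbert spaces, and let $$T^\circ=\begin{pmatrix}T^\circ_{11}&T^\circ_{12}\\ T^\circ_{21}&T^\circ_{22}\end{pmatrix},\qquad \operatorname{dom}T^\circ=\operatorname{dom}T^\circ_{11}\oplus\operatorname{dom}T^\circ_{22},$$ be a symmetric operator matrix with linear entries $T^\circ_{j1}:\operatorname{dom}T^\circ_{11}\to\mathfrak H_j$, $T^\circ_{j2}:\operatorname{dom}T^\circ_{22}\to\mathfrak H_j$ and dense domains $\operatorname{dom}T^\circ_{jj}\subseteq\mathfrak H_j$. Let $\varkappa,\tau\in\mathbb R$ satisfy $\langle(T^\circ_{11}-\varkappa)y,y\rangle\ge\|y\|^2$ on $\operatorname{dom}T^\circ_{11}$ and $\langle(\tau-T^\circ_{22})y,y\rangle\ge\|y\|^2$ on $\operatorname{dom}T^\circ_{22}$. Let $\mathfrak D_2$ be the completion of $\operatorname{dom}T^\circ_{22}$ in the norm $\langle(\tau-T^\circ_{22})y,y\rangle^{1/2}$, $I_2:\mathfrak D_2\to\mathfrak H_2$ the embedding, $\mathfrak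 D_2^*$ the space of bounded antilinear functionals on $\mathfrak D_2$, $I_2^*:\mathfrak H_2\to\mathfrak D_2^*$ the conjugate of $I_2$, $T_{22}:\mathfrak D_2\to\mathfrak D_2^*$ the continuous extension of $I_2^*T^\circ_{22}I_2$, and $T_{22}^\bullet=(I_2^*)^{-1}T_{22}I_2^{-1}$ the Friedrichs extension of $T^\circ_{22}$. Let $\mathfrak D_1$ be the completion of $\operatorname{dom}T^\circ_{11}$ in the norm $$\bigl[\langle(T^\circ_{11}-\varkappa)y,y\rangle+\langle(\tau-T^\bullet_{22})^{-1}T^\circ_{21}y,T^\circ_{21}y\rangle\bigr]^{1/2},$$ with embedding $I_1:\mathfrak D_1\to\mathfrak H_1$ and the analogous $\mathfrak D_1^*$, $I_1^*$. Let $T_{jk}:\mathfrak D_k\to\mathfrak D_j^*$ be the continuous extensions of $I_j^*T^\circ_{jk}I_k$, put $\mathfrak D=\mathfrak D_1\oplus\mathfrak D_2$, $I=I_1\oplus I_2$, $T=(T_{jk}):\mathfrak D\to\mathfrak D^*$, and let $T^\bullet=(I^*)^{-1}TI^{-1}$ (an operator in $\mathfrak H$, the angular extension of $T^\circ$). For real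 $\lambda$ in the resolvent set $\varrho(T^\bullet_{22})$ put $$S(\lambda)=T_{11}-\lambda I_1^*I_1-T_{12}\,(T_{22}-\lambda I_2^*I_2)^{-1}\,T_{21}:\ \mathfrak D_1\to\mathfrak D_1^*.$$ An operator $A:\mathfrak D_1\to\mathfrak D_1^*$ is called uniformly positive if there is $\varepsilon>0$ such that $\langle Ay,y\rangle$ is real and $\ge\varepsilon\|y\|^2$ for all $y$, and uniformly negative if $-A$ is uniformly positive. Let $\operatorname{ind}A\in\{0,1,\dots,\infty\}$ be the supremum of the dimensions of the subspaces $\mathfrak M\subseteq\mathfrak D_1$ with $\langle Ay,y\rangle<0$ for all $y\in\mathfrak M\setminus\{0\}$. The spectrum of $T^\bullet$ on a set $J\subseteq\mathbb R$ is purely discrete if every point of the spectrum in $J$ is an eigenvalue of finite multiplicity and an isolated point of the spectrum of $T^\bullet$; its total multiplicity is the sum of $\dim\ker(T^\bullet-\lambda)$ over $\lambda\in J$. Theorem. Let $\zeta^-\le\zeta^+$ be real numbers with $[\zeta^-,\zeta^+]\subseteq\varrho(T_{22}^\bullet)$. (1) If $S(\zeta^+)$ is the sum of a uniformly positive operator and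 a compact operator $\mathfrak D_1\to\mathfrak D_1^*$, then the spectrum of $T^\bullet$ on $[\zeta^-,\zeta^+)$ is purely discrete, $\operatorname{ind}S(\zeta^-)$ and $\operatorname{ind}S(\zeta^+)$ are finite, and the total multiplicity of this part of the spectrum equals $\operatorname{ind}S(\zeta^+)-\operatorname{ind}S(\zeta^-)$. (2) If $S(\zeta^-)$ is the sum of a uniformly negative operator and a compact operator $\mathfrak D_1\to\mathfrak D_1^*$, then the spectrum of $T^\bullet$ on $(\zeta^-,\zeta^+]$ is purely discrete, $\operatorname{ind}[-S(\zeta^-)]$ and $\operatorname{ind}[-S(\zeta^+)]$ are finite, and the total multiplicity of this part of the spectrum equals $\operatorname{ind}[-S(\zeta^-)]-\operatorname{ind}[-S(\zeta^+)]$. -/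

import Mathlib

set_option linter.unusedSectionVars false

noncomputable section

open scoped InnerProductSpace

/-! ## Completion of a complex vector space with respect to a scalar product -/

/-- A copy of `V` that carries the norm of the scalar product `c`. -/
def PreForm {V : Type*} [AddCommGroup V] [Module ℂ V]
    (_c : InnerProductSpace.Core ℂ V) : Type _ := V

instance {V : Type*} [AddCommGroup V] [Module ℂ V] (c : InnerProductSpace.Core ℂ V) :
    NormedAddCommGroup (PreForm c) :=
  @InnerProductSpace.Core.toNormedAddCommGroup ℂ V _ _ _ c

instance {V : Type*} [AddCommGroup V] [Module ℂ V] (c : InnerProductSpace.Core ℂ V) :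
    InnerProductSpace ℂ (PreForm c) :=
  InnerProductSpace.ofCore (𝕜 := ℂ) (F := V) c.toCore

/-- The Hilbert space completion of `V` with respect to the scalar product `c`. -/
def FormCompletion {V : Type*} [AddCommGroup V] [Module ℂ V]
    (c : InnerProductSpace.Core ℂ V) : Type _ :=
  UniformSpace.Completion (PreForm c)

instance {V : Type*} [AddCommGroup V] [Module ℂ V] (c : InnerProductSpace.Core ℂ V) :
    NormedAddCommGroup (FormCompletion c) :=
  inferInstanceAs (NormedAddCommGroup (UniformSpace.Completion (PreForm c)))

instance {V : Type*} [AddCommGroup V] [Module ℂ V] (c : InnerProductSpace.Core ℂ V) :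
    InnerProductSpace ℂ (FormCompletion c) :=
  inferInstanceAs (InnerProductSpace ℂ (UniformSpace.Completion (PreForm c)))

instance {V : Type*} [AddCommGroup V] [Module ℂ V] (c : InnerProductSpace.Core ℂ V) :
    CompleteSpace (FormCompletion c) :=
  inferInstanceAs (CompleteSpace (UniformSpace.Completion (PreForm c)))

namespace FormCompletion

variable {V : Type*} [AddCommGroup V] [Module ℂ V] (c : InnerProductSpace.Core ℂ V)

/-- The canonical map of `V` into its completion. -/
def ι : V →ₗ[ℂ] FormCompletion c :=
  (UniformSpace.Completion.toComplₗᵢ (𝕜 := ℂ) (E := PreForm c)).toLinearMap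

theorem inner_ι (x y : V) : ⟪ι c x, ι c y⟫_ℂ = c.inner x y :=
  UniformSpace.Completion.inner_coe (𝕜 := ℂ) (E := PreForm c) x y

theorem norm_ι_sq (x : V) : ‖ι c x‖ ^ 2 = (c.inner x x).re := by
  rw [← inner_ι c x x, ← inner_self_eq_norm_sq (𝕜 := ℂ)]
  rfl

theorem denseRange_ι : DenseRange (ι c) :=
  UniformSpace.Completion.denseRange_coe (α := PreForm c)

variable {c} in
theorem extendOfNorm_eq_of_comp {F : Type*} [NormedAddCommGroup F] [NormedSpace ℂ F]
    [CompleteSpace F] {f : V →ₗ[ℂ] F} {g : FormCompletion c →L[ℂ] F}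
    (h : ∀ x, g (ι c x) = f x) : f.extendOfNorm (ι c) = g :=
  LinearMap.extendOfNorm_unique (denseRange_ι c) ‖g‖
    (fun x => by rw [← h]; exact g.le_opNorm _) g (LinearMap.ext h)

end FormCompletion

/-! ## Unbounded operators: resolvent set and eigenspaces -/

section Unbounded

variable {B : Type*} [NormedAddCommGroup B] [NormedSpace ℂ B]

/-- The bounded, everywhere defined operator `R` is the inverse of `A - z`. -/
def IsResolventAt (A : B →ₗ.[ℂ] B) (z : ℂ) (R : B →L[ℂ] B) : Prop :=
  (∀ h : B, ∃ x : A.domain, (x : B) = R h ∧ A x - z • (x : B) = h) ∧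
    ∀ x : A.domain, R (A x - z • (x : B)) = x

/-- The resolvent set of an unbounded operator. -/
def opResolventSet (A : B →ₗ.[ℂ] B) : Set ℂ := {z | ∃ R : B →L[ℂ] B, IsResolventAt A z R}

/-- The spectrum of an unbounded operator. -/
def opSpectrum (A : B →ₗ.[ℂ] B) : Set ℂ := (opResolventSet A)ᶜ

open scoped Classical in
/-- The resolvent `(A - z)⁻¹` (and `0` outside of the resolvent set). -/
def opResolvent (A : B →ₗ.[ℂ] B) (z : ℂ) : B →L[ℂ] B :=
  if h : ∃ R : B →L[ℂ] B, IsResolventAt A z R then h.choose else 0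

theorem IsResolventAt.eq_opResolvent {A : B →ₗ.[ℂ] B} {z : ℂ} {R : B →L[ℂ] B}
    (hR : IsResolventAt A z R) : opResolvent A z = R := by
  have hex : ∃ R : B →L[ℂ] B, IsResolventAt A z R := ⟨R, hR⟩
  have h1 : opResolvent A z = hex.choose := dif_pos hex
  rw [h1]
  ext h
  obtain ⟨x, hx, hxh⟩ := hR.1 h
  have := hex.choose_spec.2 x
  rw [hxh] at this
  rw [this, hx]

/-- The kernel of `A - z`, as a subspace of the domain of `A`. -/
def opKer (A : B →ₗ.[ℂ] B) (z : ℂ) : Submodule ℂ A.domain :=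
  LinearMap.ker (A.toFun - z • A.domain.subtype)

/-- The spectrum of `A` on `J ⊆ ℝ` is purely discrete: it consists of eigenvalues of finite
multiplicity that are isolated points of the spectrum of `A`. -/
def IsPurelyDiscreteOn (A : B →ₗ.[ℂ] B) (J : Set ℝ) : Prop :=
  ∀ l ∈ J, (l : ℂ) ∈ opSpectrum A →
    opKer A l ≠ ⊥ ∧ FiniteDimensional ℂ (opKer A l) ∧
      ∃ r > 0, ∀ z : ℂ, z ≠ l → ‖z - l‖ < r → z ∈ opResolventSet A

/-- The total multiplicity of the eigenvalues of `A` in `J ⊆ ℝ`: the sum of `dim ker (A - l)`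
over all `l ∈ J`, an element of `ℕ ∪ {∞}`. -/
def totalMultiplicity (A : B →ₗ.[ℂ] B) (J : Set ℝ) : ℕ∞ :=
  ⨆ F : Finset ℝ, ⨆ _ : (F : Set ℝ) ⊆ J,
    ∑ l ∈ F, Cardinal.toENat (Module.rank ℂ (opKer A l))

end Unbounded

/-! ## Riggings -/

/-- The conjugate space of a complex Hilbert space: the bounded antilinear functionals. -/
abbrev ConjSpace (D : Type*) [NormedAddCommGroup D] [InnerProductSpace ℂ D] : Type _ :=
  D →L⋆[ℂ] ℂ

section Rigging

variable {D H : Type*} [NormedAddCommGroup D] [InnerProductSpace ℂ D]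
  [NormedAddCommGroup H] [InnerProductSpace ℂ H]

/-- The conjugate `E^* → D^*`, `f ↦ f ∘ P`, of a bounded operator `P : D → E`. -/
def pullback {E : Type*} [NormedAddCommGroup E] [InnerProductSpace ℂ E] (P : D →L[ℂ] E) :
    ConjSpace E →L[ℂ] ConjSpace D :=
  (ContinuousLinearMap.compSL D E ℂ (RingHom.id ℂ) (starRingEnd ℂ)).flip P

@[simp]
theorem pullback_apply {E : Type*} [NormedAddCommGroup E] [InnerProductSpace ℂ E]
    (P : D →L[ℂ] E) (f : ConjSpace E) (z : D) : pullback P f z = f (P z) := rfl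

/-- The conjugate `I^* : H → D^*` of `I : D → H`, where `H` is identified with `H^*`: `I^* h` is
the functional that maps `z` to the scalar product of `h` and `I z` (Mathlib's scalar product is
antilinear in the first place). -/
def conjOp (I : D →L[ℂ] H) : H →L[ℂ] ConjSpace D := pullback I ∘L innerSLFlip ℂ

@[simp]
theorem conjOp_apply (I : D →L[ℂ] H) (h : H) (z : D) : conjOp I h z = ⟪I z, h⟫_ℂ := rfl

theorem conjOp_injective {I : D →L[ℂ] H} (hI : DenseRange I) : Function.Injective (conjOp I) := by
  refine (injective_iff_map_eq_zero _).2 fun h hh => ?_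
  refine hI.eq_zero_of_inner_right ℂ fun z => ?_
  rw [← conjOp_apply, hh]
  rfl

end Rigging

section Bullet

variable {B Dp Dm : Type*} [NormedAddCommGroup B] [NormedSpace ℂ B]
  [NormedAddCommGroup Dp] [NormedSpace ℂ Dp] [NormedAddCommGroup Dm] [NormedSpace ℂ Dm]

/-- The graph `{(Ip y, h) | T y = Im h}` of the operator `Im⁻¹ T Ip⁻¹`. -/
def bulletGraph (Ip : Dp →L[ℂ] B) (Im : B →L[ℂ] Dm) (T : Dp →L[ℂ] Dm) : Submodule ℂ (B × B) where
  carrier := {p | ∃ y : Dp, Ip y = p.1 ∧ T y = Im p.2}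
  zero_mem' := ⟨0, by simp⟩
  add_mem' := by
    rintro p q ⟨y, hy, hy'⟩ ⟨z, hz, hz'⟩
    exact ⟨y + z, by simp [hy, hz], by simp [hy', hz']⟩
  smul_mem' := by
    rintro a p ⟨y, hy, hy'⟩
    exact ⟨a • y, by simp [hy], by simp [hy']⟩

/-- The operator `T^• = Im⁻¹ T Ip⁻¹` in `B` that an operator `T : Dp → Dm` induces in a rigging
`Dp → B → Dm` (with injective `Ip` and `Im`). -/
def bullet (Ip : Dp →L[ℂ] B) (Im : B →L[ℂ] Dm) (T : Dp →L[ℂ] Dm) : B →ₗ.[ℂ] B :=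
  (bulletGraph Ip Im T).toLinearPMap

theorem bullet_graph {Ip : Dp →L[ℂ] B} {Im : B →L[ℂ] Dm} (hp : Function.Injective Ip)
    (hm : Function.Injective Im) (T : Dp →L[ℂ] Dm) :
    (bullet Ip Im T).graph = bulletGraph Ip Im T := by
  refine Submodule.toLinearPMap_graph_eq _ ?_
  rintro p ⟨y, hy, hy'⟩ h0
  have : y = 0 := hp (by rw [hy, h0, map_zero])
  rw [this, map_zero] at hy'
  exact hm (by rw [← hy', map_zero])

end Bullet

/-! ## Quadratic forms of operators `D → D^*` -/

section Forms

variable {D : Type*} [NormedAddCommGroup D] [InnerProductSpace ℂ D]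

/-- Uniform positivity of an operator `A : D → D^*`: the quadratic form of `A` is real and bounded
from below by `ε ‖y‖²` for some `ε > 0`. -/
def IsUniformlyPositive (A : D →L[ℂ] ConjSpace D) : Prop :=
  ∃ ε : ℝ, 0 < ε ∧ ∀ y : D, (A y y).im = 0 ∧ ε * ‖y‖ ^ 2 ≤ (A y y).re

/-- Uniform negativity of an operator `A : D → D^*`. -/
def IsUniformlyNegative (A : D →L[ℂ] ConjSpace D) : Prop :=
  ∃ ε : ℝ, 0 < ε ∧ ∀ y : D, (A y y).im = 0 ∧ (A y y).re ≤ -(ε * ‖y‖ ^ 2)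

/-- `A` is a compact perturbation of some operator with the property `P`. -/
def IsCompactPerturbationOf (P : (D →L[ℂ] ConjSpace D) → Prop) (A : D →L[ℂ] ConjSpace D) : Prop :=
  ∃ A₀ K : D →L[ℂ] ConjSpace D, P A₀ ∧ IsCompactOperator K ∧ A = A₀ + K

/-- The negative index of inertia of (the quadratic form of) `A`: the supremum of the dimensions
of the subspaces on which the form is negative definite. -/
def negIndex (A : D →L[ℂ] ConjSpace D) : ℕ∞ :=
  ⨆ M : Submodule ℂ D, ⨆ _ : ∀ y ∈ M, y ≠ 0 → (A y y).re < 0,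
    Cardinal.toENat (Module.rank ℂ M)

end Forms

/-! ## Symmetric operator matrices and their angular extensions -/

/-- A symmetric operator matrix with the domain `dom T₁₁ ⊕ dom T₂₂`, where `T₁₁` is bounded from
below and `T₂₂` is bounded from above, with the fixed bounds `ϰ` and `τ`. -/
structure BlockMatrix (H₁ H₂ : Type*) [NormedAddCommGroup H₁] [InnerProductSpace ℂ H₁]
    [NormedAddCommGroup H₂] [InnerProductSpace ℂ H₂] where
  /-- upper left entry -/
  T₁₁ : H₁ →ₗ.[ℂ] H₁
  /-- lower right entry -/
  T₂₂ : H₂ →ₗ.[ℂ] H₂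
  /-- upper right entry -/
  T₁₂ : T₂₂.domain →ₗ[ℂ] H₁
  /-- lower left entry -/
  T₂₁ : T₁₁.domain →ₗ[ℂ] H₂
  dense₁ : Dense (T₁₁.domain : Set H₁)
  dense₂ : Dense (T₂₂.domain : Set H₂)
  symm₁₁ : ∀ y z : T₁₁.domain, ⟪T₁₁ y, (z : H₁)⟫_ℂ = ⟪(y : H₁), T₁₁ z⟫_ℂ
  symm₂₂ : ∀ y z : T₂₂.domain, ⟪T₂₂ y, (z : H₂)⟫_ℂ = ⟪(y : H₂), T₂₂ z⟫_ℂ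
  symm₂₁ : ∀ (y : T₁₁.domain) (z : T₂₂.domain), ⟪T₂₁ y, (z : H₂)⟫_ℂ = ⟪(y : H₁), T₁₂ z⟫_ℂ
  /-- the parameter of the lower bound of `T₁₁` -/
  ϰ : ℝ
  /-- the parameter of the upper bound of `T₂₂` -/
  τ : ℝ
  lower : ∀ y : T₁₁.domain, ‖(y : H₁)‖ ^ 2 ≤ (⟪T₁₁ y - (ϰ : ℂ) • (y : H₁), (y : H₁)⟫_ℂ).re
  upper : ∀ y : T₂₂.domain, ‖(y : H₂)‖ ^ 2 ≤ (⟪(τ : ℂ) • (y : H₂) - T₂₂ y, (y : H₂)⟫_ℂ).re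

namespace BlockMatrix

variable {H₁ H₂ : Type*} [NormedAddCommGroup H₁] [InnerProductSpace ℂ H₁] [CompleteSpace H₁]
  [NormedAddCommGroup H₂] [InnerProductSpace ℂ H₂] [CompleteSpace H₂] (M : BlockMatrix H₁ H₂)

/-! ### The space `D₂` and the Friedrichs extension of `T₂₂` -/

/-- The scalar product `⟨(τ - T₂₂) y, z⟩` on `dom T₂₂`. -/
@[reducible]
def core₂ : InnerProductSpace.Core ℂ M.T₂₂.domain where
  inner y z := ⟪(M.τ : ℂ) • (y : H₂) - M.T₂₂ y, (z : H₂)⟫_ℂ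
  conj_inner_symm y z := by
    simp only [inner_sub_left, inner_smul_left, map_sub, map_mul, inner_conj_symm, Complex.conj_ofReal]
    rw [M.symm₂₂]
  re_inner_nonneg y := (sq_nonneg _).trans (M.upper y)
  add_left x y z := by
    simp only [Submodule.coe_add, LinearPMap.map_add, inner_sub_left, smul_add, inner_add_left]
    ring
  smul_left x y r := by
    simp only [Submodule.coe_smul, LinearPMap.map_smul, inner_sub_left, inner_smul_left]
    ring
  definite y hy := by
    have h := M.upper y
    rw [hy] at h
    have h' : ‖(y : H₂)‖ = 0 := by
      have := sq_nonneg ‖(y : H₂)‖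
      exact pow_eq_zero_iff (two_ne_zero) |>.1 (le_antisymm (by simpa using h) this)
    exact Subtype.ext (norm_eq_zero.1 h')

/-- The space `D₂`: the completion of `dom T₂₂` in the norm `⟨(τ - T₂₂) y, y⟩ ^ (1 / 2)`. -/
abbrev D₂ : Type _ := FormCompletion M.core₂

/-- The canonical map `dom T₂₂ → D₂`. -/
def ι₂ : M.T₂₂.domain →ₗ[ℂ] M.D₂ := FormCompletion.ι M.core₂

/-- The embedding `I₂ : D₂ → H₂`, the continuous extension of the inclusion of `dom T₂₂`. -/
def I₂ : M.D₂ →L[ℂ] H₂ := M.T₂₂.domain.subtype.extendOfNorm M.ι₂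

/-- The operator `T₂₂ : D₂ → D₂^*`, the continuous extension of `I₂^* T₂₂ I₂`. -/
def A₂₂ : M.D₂ →L[ℂ] ConjSpace M.D₂ :=
  ((conjOp M.I₂).toLinearMap ∘ₗ M.T₂₂.toFun).extendOfNorm M.ι₂

/-- The Friedrichs extension `T₂₂^•` of `T₂₂`. -/
def bullet₂₂ : H₂ →ₗ.[ℂ] H₂ := bullet M.I₂ (conjOp M.I₂) M.A₂₂

theorem denseRange_ι₂ : DenseRange M.ι₂ := FormCompletion.denseRange_ι _

theorem inner_ι₂ (y z : M.T₂₂.domain) :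
    ⟪M.ι₂ y, M.ι₂ z⟫_ℂ = ⟪(M.τ : ℂ) • (y : H₂) - M.T₂₂ y, (z : H₂)⟫_ℂ :=
  FormCompletion.inner_ι _ _ _

theorem norm_le_ι₂ (y : M.T₂₂.domain) : ‖(y : H₂)‖ ≤ ‖M.ι₂ y‖ := by
  refine le_of_sq_le_sq ?_ (norm_nonneg _)
  exact (M.upper y).trans_eq (FormCompletion.norm_ι_sq M.core₂ y).symm

theorem I₂_ι (y : M.T₂₂.domain) : M.I₂ (M.ι₂ y) = y :=
  LinearMap.extendOfNorm_eq M.denseRange_ι₂ ⟨1, fun y => by simpa using M.norm_le_ι₂ y⟩ y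

theorem inner_ι₂_left (y : M.T₂₂.domain) (z : M.D₂) :
    ⟪M.ι₂ y, z⟫_ℂ = ⟪(M.τ : ℂ) • (y : H₂) - M.T₂₂ y, M.I₂ z⟫_ℂ := by
  refine M.denseRange_ι₂.induction_on (p := fun z => ⟪M.ι₂ y, z⟫_ℂ =
    ⟪(M.τ : ℂ) • (y : H₂) - M.T₂₂ y, M.I₂ z⟫_ℂ) z
    (isClosed_eq (by fun_prop) (by fun_prop)) fun z => ?_
  rw [inner_ι₂, I₂_ι]

theorem I₂_injective : Function.Injective M.I₂ := by
  refine (injective_iff_map_eq_zero _).2 fun y hy => ?_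
  refine M.denseRange_ι₂.eq_zero_of_inner_right ℂ fun v => ?_
  rw [inner_ι₂_left, hy, inner_zero_right]

theorem denseRange_I₂ : DenseRange M.I₂ := by
  refine M.dense₂.mono ?_
  intro y hy
  exact ⟨M.ι₂ ⟨y, hy⟩, M.I₂_ι _⟩

theorem conjOp_I₂_T₂₂ (y : M.T₂₂.domain) (z : M.D₂) :
    conjOp M.I₂ (M.T₂₂ y) z = M.τ * ⟪M.I₂ z, M.I₂ (M.ι₂ y)⟫_ℂ - ⟪z, M.ι₂ y⟫_ℂ := by
  rw [conjOp_apply, ← inner_conj_symm z (M.ι₂ y), inner_ι₂_left, inner_conj_symm, I₂_ι,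
    inner_sub_right, inner_smul_right]
  ring

/-- `T₂₂ = τ I₂^* I₂ - J`, where `J : D₂ → D₂^*` is the Riesz isomorphism. -/
theorem A₂₂_eq : M.A₂₂ = (M.τ : ℂ) • (conjOp M.I₂ ∘L M.I₂) - innerSLFlip ℂ :=
  FormCompletion.extendOfNorm_eq_of_comp fun y => by
    ext z
    exact (M.conjOp_I₂_T₂₂ y z).symm

theorem A₂₂_ι (y : M.T₂₂.domain) : M.A₂₂ (M.ι₂ y) = conjOp M.I₂ (M.T₂₂ y) := by
  rw [A₂₂_eq]
  ext z
  exact (M.conjOp_I₂_T₂₂ y z).symm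

theorem A₂₂_apply (y z : M.D₂) : M.A₂₂ y z = M.τ * ⟪M.I₂ z, M.I₂ y⟫_ℂ - ⟪z, y⟫_ℂ := by
  rw [A₂₂_eq]
  rfl

theorem graph_bullet₂₂ : M.bullet₂₂.graph = bulletGraph M.I₂ (conjOp M.I₂) M.A₂₂ :=
  bullet_graph M.I₂_injective (conjOp_injective M.denseRange_I₂) _

theorem isResolventAt_τ :
    IsResolventAt M.bullet₂₂ M.τ (-(M.I₂ ∘L ContinuousLinearMap.adjoint M.I₂)) := by
  constructor
  · intro h
    set y := -(ContinuousLinearMap.adjoint M.I₂ h) with hy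
    have hmem : (M.I₂ y, h + (M.τ : ℂ) • M.I₂ y) ∈ M.bullet₂₂.graph := by
      rw [graph_bullet₂₂]
      refine ⟨y, rfl, ?_⟩
      ext z
      rw [A₂₂_apply, conjOp_apply, inner_add_right, inner_smul_right]
      have : ⟪z, y⟫_ℂ = -⟪M.I₂ z, h⟫_ℂ := by
        rw [hy, inner_neg_right, ContinuousLinearMap.adjoint_inner_right]
      rw [this]
      ring
    obtain ⟨x, hx, hx'⟩ := (LinearPMap.mem_graph_iff _).1 hmem
    refine ⟨x, ?_, ?_⟩
    · rw [hx, hy]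
      simp
    · rw [hx', hx]
      simp
  · intro x
    have hmem := M.bullet₂₂.mem_graph x
    rw [graph_bullet₂₂] at hmem
    obtain ⟨y, hy, hy'⟩ := hmem
    have : y = ContinuousLinearMap.adjoint M.I₂ ((M.τ : ℂ) • (x : H₂) - M.bullet₂₂ x) := by
      refine ext_inner_left ℂ fun z => ?_
      have h := congrArg (fun f => f z) hy'
      simp only [A₂₂_apply, conjOp_apply] at h hy
      rw [ContinuousLinearMap.adjoint_inner_right, inner_sub_right, inner_smul_right, ← h, ← hy]
      ring
    have h2 := congrArg M.I₂ this
    rw [hy] at h2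
    simp only at h2
    conv_rhs => rw [h2]
    simp only [neg_apply, ContinuousLinearMap.comp_apply, map_sub]
    abel

/-- The bounded operator `(τ - T₂₂^•)⁻¹` in `H₂`. -/
def R : H₂ →L[ℂ] H₂ := -opResolvent M.bullet₂₂ M.τ

theorem inner_R (h k : H₂) : ⟪M.R h, k⟫_ℂ =
    ⟪ContinuousLinearMap.adjoint M.I₂ h, ContinuousLinearMap.adjoint M.I₂ k⟫_ℂ := by
  rw [R, M.isResolventAt_τ.eq_opResolvent, neg_neg, ContinuousLinearMap.adjoint_inner_right]
  rfl

/-! ### The space `D₁` -/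

/-- The scalar product `⟨(T₁₁ - ϰ) y, z⟩ + ⟨(τ - T₂₂^•)⁻¹ T₂₁ y, T₂₁ z⟩` on `dom T₁₁`. -/
@[reducible]
def core₁ : InnerProductSpace.Core ℂ M.T₁₁.domain where
  inner y z := ⟪M.T₁₁ y - (M.ϰ : ℂ) • (y : H₁), (z : H₁)⟫_ℂ + ⟪M.R (M.T₂₁ y), M.T₂₁ z⟫_ℂ
  conj_inner_symm y z := by
    simp only [inner_R, inner_sub_left, inner_smul_left, map_sub, map_add, map_mul,
      inner_conj_symm, Complex.conj_ofReal]
    rw [M.symm₁₁]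
  re_inner_nonneg y := by
    rw [inner_R]
    exact add_nonneg ((sq_nonneg _).trans (M.lower y)) (inner_self_nonneg (𝕜 := ℂ))
  add_left x y z := by
    simp only [Submodule.coe_add, LinearPMap.map_add, inner_sub_left, smul_add, inner_add_left,
      map_add]
    ring
  smul_left x y r := by
    simp only [Submodule.coe_smul, LinearPMap.map_smul, inner_sub_left, inner_smul_left, map_smul]
    ring
  definite y hy := by
    rw [inner_R] at hy
    have h := M.lower y
    have h1 := congrArg Complex.re hy
    have h2 : 0 ≤ (⟪ContinuousLinearMap.adjoint M.I₂ (M.T₂₁ y),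
      ContinuousLinearMap.adjoint M.I₂ (M.T₂₁ y)⟫_ℂ).re := inner_self_nonneg (𝕜 := ℂ)
    rw [Complex.add_re, Complex.zero_re] at h1
    have h3 : ‖(y : H₁)‖ ^ 2 ≤ 0 := by linarith
    have h4 : ‖(y : H₁)‖ = 0 :=
      (pow_eq_zero_iff two_ne_zero).1 (le_antisymm h3 (sq_nonneg _))
    exact Subtype.ext (norm_eq_zero.1 h4)

/-- The space `D₁`: the completion of `dom T₁₁` in the norm
`[⟨(T₁₁ - ϰ) y, y⟩ + ⟨(τ - T₂₂^•)⁻¹ T₂₁ y, T₂₁ y⟩] ^ (1 / 2)`. -/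
abbrev D₁ : Type _ := FormCompletion M.core₁

/-- The canonical map `dom T₁₁ → D₁`. -/
def ι₁ : M.T₁₁.domain →ₗ[ℂ] M.D₁ := FormCompletion.ι M.core₁

/-- The embedding `I₁ : D₁ → H₁`, the continuous extension of the inclusion of `dom T₁₁`. -/
def I₁ : M.D₁ →L[ℂ] H₁ := M.T₁₁.domain.subtype.extendOfNorm M.ι₁

/-- The operator `T₁₁ : D₁ → D₁^*`, the continuous extension of `I₁^* T₁₁ I₁`. -/
def A₁₁ : M.D₁ →L[ℂ] ConjSpace M.D₁ :=
  ((conjOp M.I₁).toLinearMap ∘ₗ M.T₁₁.toFun).extendOfNorm M.ι₁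

/-- The operator `T₂₁ : D₁ → D₂^*`, the continuous extension of `I₂^* T₂₁ I₁`. -/
def A₂₁ : M.D₁ →L[ℂ] ConjSpace M.D₂ :=
  ((conjOp M.I₂).toLinearMap ∘ₗ M.T₂₁).extendOfNorm M.ι₁

/-- The operator `T₁₂ : D₂ → D₁^*`, the continuous extension of `I₁^* T₁₂ I₂`. -/
def A₁₂ : M.D₂ →L[ℂ] ConjSpace M.D₁ :=
  ((conjOp M.I₁).toLinearMap ∘ₗ M.T₁₂).extendOfNorm M.ι₂

theorem denseRange_ι₁ : DenseRange M.ι₁ := FormCompletion.denseRange_ι _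

theorem inner_ι₁ (y z : M.T₁₁.domain) :
    ⟪M.ι₁ y, M.ι₁ z⟫_ℂ = ⟪M.T₁₁ y - (M.ϰ : ℂ) • (y : H₁), (z : H₁)⟫_ℂ +
      ⟪ContinuousLinearMap.adjoint M.I₂ (M.T₂₁ y),
        ContinuousLinearMap.adjoint M.I₂ (M.T₂₁ z)⟫_ℂ := by
  rw [← inner_R]
  exact FormCompletion.inner_ι _ _ _

theorem norm_ι₁_sq (y : M.T₁₁.domain) :
    ‖(y : H₁)‖ ^ 2 + ‖ContinuousLinearMap.adjoint M.I₂ (M.T₂₁ y)‖ ^ 2 ≤ ‖M.ι₁ y‖ ^ 2 := by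
  have h1 : ‖M.ι₁ y‖ ^ 2 = (⟪M.ι₁ y, M.ι₁ y⟫_ℂ).re := (inner_self_eq_norm_sq (𝕜 := ℂ) _).symm
  have h2 : ‖ContinuousLinearMap.adjoint M.I₂ (M.T₂₁ y)‖ ^ 2 =
    (⟪ContinuousLinearMap.adjoint M.I₂ (M.T₂₁ y),
      ContinuousLinearMap.adjoint M.I₂ (M.T₂₁ y)⟫_ℂ).re := (inner_self_eq_norm_sq (𝕜 := ℂ) _).symm
  rw [h1, h2, inner_ι₁, Complex.add_re]
  linarith [M.lower y]

theorem norm_le_ι₁ (y : M.T₁₁.domain) : ‖(y : H₁)‖ ≤ ‖M.ι₁ y‖ := by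
  refine le_of_sq_le_sq ?_ (norm_nonneg _)
  nlinarith [M.norm_ι₁_sq y, sq_nonneg ‖ContinuousLinearMap.adjoint M.I₂ (M.T₂₁ y)‖]

theorem norm_adjoint_T₂₁_le (y : M.T₁₁.domain) :
    ‖ContinuousLinearMap.adjoint M.I₂ (M.T₂₁ y)‖ ≤ ‖M.ι₁ y‖ := by
  refine le_of_sq_le_sq ?_ (norm_nonneg _)
  nlinarith [M.norm_ι₁_sq y, sq_nonneg ‖(y : H₁)‖]

theorem I₁_ι (y : M.T₁₁.domain) : M.I₁ (M.ι₁ y) = y :=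
  LinearMap.extendOfNorm_eq M.denseRange_ι₁ ⟨1, fun y => by simpa using M.norm_le_ι₁ y⟩ y

theorem denseRange_I₁ : DenseRange M.I₁ := by
  refine M.dense₁.mono ?_
  intro y hy
  exact ⟨M.ι₁ ⟨y, hy⟩, M.I₁_ι _⟩

/-- The extension of `I₂^† T₂₁` to `D₁` (with the Hilbert space adjoint of `I₂`). -/
def G : M.D₁ →L[ℂ] M.D₂ :=
  ((ContinuousLinearMap.adjoint M.I₂).toLinearMap ∘ₗ M.T₂₁).extendOfNorm M.ι₁

theorem G_ι (y : M.T₁₁.domain) : M.G (M.ι₁ y) = ContinuousLinearMap.adjoint M.I₂ (M.T₂₁ y) :=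
  LinearMap.extendOfNorm_eq M.denseRange_ι₁
    ⟨1, fun y => by simpa using M.norm_adjoint_T₂₁_le y⟩ y

theorem G_eq_A₂₁ (y : M.T₁₁.domain) :
    innerSLFlip ℂ (M.G (M.ι₁ y)) = conjOp M.I₂ (M.T₂₁ y) := by
  ext z
  change ⟪z, M.G (M.ι₁ y)⟫_ℂ = ⟪M.I₂ z, M.T₂₁ y⟫_ℂ
  rw [G_ι, ContinuousLinearMap.adjoint_inner_right]

theorem A₂₁_eq : M.A₂₁ = innerSLFlip ℂ ∘L M.G :=
  FormCompletion.extendOfNorm_eq_of_comp M.G_eq_A₂₁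

theorem A₂₁_ι (y : M.T₁₁.domain) : M.A₂₁ (M.ι₁ y) = conjOp M.I₂ (M.T₂₁ y) := by
  rw [A₂₁_eq]
  exact M.G_eq_A₂₁ y

theorem inner_ι₂_G (w : M.T₂₂.domain) (y : M.D₁) :
    ⟪M.ι₂ w, M.G y⟫_ℂ = ⟪M.T₁₂ w, M.I₁ y⟫_ℂ := by
  refine M.denseRange_ι₁.induction_on (p := fun y => ⟪M.ι₂ w, M.G y⟫_ℂ =
    ⟪M.T₁₂ w, M.I₁ y⟫_ℂ) y (isClosed_eq (by fun_prop) (by fun_prop)) fun y => ?_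
  rw [G_ι, I₁_ι, ContinuousLinearMap.adjoint_inner_right, I₂_ι, ← inner_conj_symm, M.symm₂₁,
    inner_conj_symm]

theorem inner_ι₁_left (y : M.T₁₁.domain) (z : M.D₁) :
    ⟪M.ι₁ y, z⟫_ℂ = ⟪M.T₁₁ y - (M.ϰ : ℂ) • (y : H₁), M.I₁ z⟫_ℂ + ⟪M.G (M.ι₁ y), M.G z⟫_ℂ := by
  refine M.denseRange_ι₁.induction_on (p := fun z => ⟪M.ι₁ y, z⟫_ℂ =
    ⟪M.T₁₁ y - (M.ϰ : ℂ) • (y : H₁), M.I₁ z⟫_ℂ + ⟪M.G (M.ι₁ y), M.G z⟫_ℂ) z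
    (isClosed_eq (by fun_prop) (by fun_prop)) fun z => ?_
  rw [inner_ι₁, I₁_ι, G_ι, G_ι]

theorem I₁_injective : Function.Injective M.I₁ := by
  refine (injective_iff_map_eq_zero _).2 fun y hy => ?_
  have hG : M.G y = 0 := M.denseRange_ι₂.eq_zero_of_inner_right ℂ fun w => by
    rw [inner_ι₂_G, hy, inner_zero_right]
  refine M.denseRange_ι₁.eq_zero_of_inner_right ℂ fun v => ?_
  rw [inner_ι₁_left, hy, hG, inner_zero_right, inner_zero_right, add_zero]

theorem A₁₁_aux (y : M.T₁₁.domain) :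
    (innerSLFlip ℂ + (M.ϰ : ℂ) • (conjOp M.I₁ ∘L M.I₁) -
      pullback M.G ∘L innerSLFlip ℂ ∘L M.G : M.D₁ →L[ℂ] ConjSpace M.D₁) (M.ι₁ y) = conjOp M.I₁ (M.T₁₁ y) := by
  ext z
  change ⟪z, M.ι₁ y⟫_ℂ + M.ϰ * ⟪M.I₁ z, M.I₁ (M.ι₁ y)⟫_ℂ - ⟪M.G z, M.G (M.ι₁ y)⟫_ℂ =
    ⟪M.I₁ z, M.T₁₁ y⟫_ℂ
  rw [← inner_conj_symm z (M.ι₁ y), inner_ι₁_left, map_add, inner_conj_symm, inner_conj_symm,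
    I₁_ι, inner_sub_right, inner_smul_right]
  ring

theorem A₁₁_eq : M.A₁₁ = innerSLFlip ℂ + (M.ϰ : ℂ) • (conjOp M.I₁ ∘L M.I₁) -
    pullback M.G ∘L innerSLFlip ℂ ∘L M.G :=
  FormCompletion.extendOfNorm_eq_of_comp M.A₁₁_aux

theorem A₁₁_ι (y : M.T₁₁.domain) : M.A₁₁ (M.ι₁ y) = conjOp M.I₁ (M.T₁₁ y) := by
  rw [A₁₁_eq]
  exact M.A₁₁_aux y

theorem A₁₂_aux (y : M.T₂₂.domain) :
    (pullback M.G ∘L innerSLFlip ℂ) (M.ι₂ y) = conjOp M.I₁ (M.T₁₂ y) := by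
  ext z
  change ⟪M.G z, M.ι₂ y⟫_ℂ = ⟪M.I₁ z, M.T₁₂ y⟫_ℂ
  rw [← inner_conj_symm, inner_ι₂_G, inner_conj_symm]

theorem A₁₂_eq : M.A₁₂ = pullback M.G ∘L innerSLFlip ℂ :=
  FormCompletion.extendOfNorm_eq_of_comp M.A₁₂_aux

theorem A₁₂_ι (y : M.T₂₂.domain) : M.A₁₂ (M.ι₂ y) = conjOp M.I₁ (M.T₁₂ y) := by
  rw [A₁₂_eq]
  exact M.A₁₂_aux y

/-! ### The angular extension -/

/-- The space `D = D₁ ⊕ D₂`. -/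
abbrev D : Type _ := WithLp 2 (M.D₁ × M.D₂)

/-- The embedding `I = I₁ ⊕ I₂` of `D` into `H = H₁ ⊕ H₂`. -/
def I : M.D →L[ℂ] WithLp 2 (H₁ × H₂) :=
  ((WithLp.prodContinuousLinearEquiv 2 ℂ H₁ H₂).symm : H₁ × H₂ →L[ℂ] WithLp 2 (H₁ × H₂)) ∘L
    (M.I₁.prodMap M.I₂) ∘L
      ((WithLp.prodContinuousLinearEquiv 2 ℂ M.D₁ M.D₂) : M.D →L[ℂ] M.D₁ × M.D₂)

/-- The bounded operator `T : D → D^*` given by the matrix of the operators `A₁₁`, `A₁₂`, `A₂₁`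
and `A₂₂`. -/
def A : M.D →L[ℂ] ConjSpace M.D :=
  pullback (WithLp.fstL 2 ℂ M.D₁ M.D₂) ∘L
      (M.A₁₁ ∘L WithLp.fstL 2 ℂ M.D₁ M.D₂ + M.A₁₂ ∘L WithLp.sndL 2 ℂ M.D₁ M.D₂) +
    pullback (WithLp.sndL 2 ℂ M.D₁ M.D₂) ∘L
      (M.A₂₁ ∘L WithLp.fstL 2 ℂ M.D₁ M.D₂ + M.A₂₂ ∘L WithLp.sndL 2 ℂ M.D₁ M.D₂)

/-- The angular extension `T^•` of the operator matrix. -/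
def angularExtension : WithLp 2 (H₁ × H₂) →ₗ.[ℂ] WithLp 2 (H₁ × H₂) :=
  bullet M.I (conjOp M.I) M.A

/-- The Schur complement
`S(l) = T₁₁ - l I₁^* I₁ - T₁₂ (T₂₂ - l I₂^* I₂)⁻¹ T₂₁ : D₁ → D₁^*`. -/
def S (l : ℝ) : M.D₁ →L[ℂ] ConjSpace M.D₁ :=
  M.A₁₁ - (l : ℂ) • (conjOp M.I₁ ∘L M.I₁) -
    M.A₁₂ ∘L (M.A₂₂ - (l : ℂ) • (conjOp M.I₂ ∘L M.I₂)).inverse ∘L M.A₂₁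

theorem I_apply (y : M.D) : M.I y = WithLp.toLp 2 (M.I₁ y.fst, M.I₂ y.snd) := rfl

theorem A_apply (y z : M.D) : M.A y z =
    M.A₁₁ y.fst z.fst + M.A₁₂ y.snd z.fst + (M.A₂₁ y.fst z.snd + M.A₂₂ y.snd z.snd) := rfl

theorem I_injective : Function.Injective M.I := by
  intro y z h
  rw [I_apply, I_apply] at h
  have h1 := congrArg WithLp.fst h
  have h2 := congrArg WithLp.snd h
  exact WithLp.ofLp_injective 2 (Prod.ext (M.I₁_injective h1) (M.I₂_injective h2))

theorem denseRange_I : DenseRange M.I := by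
  have h1 : DenseRange (Prod.map M.I₁ M.I₂) := M.denseRange_I₁.prodMap M.denseRange_I₂
  have h2 : DenseRange (WithLp.prodContinuousLinearEquiv 2 ℂ H₁ H₂).symm :=
    (WithLp.prodContinuousLinearEquiv 2 ℂ H₁ H₂).symm.surjective.denseRange
  have h3 : DenseRange (WithLp.prodContinuousLinearEquiv 2 ℂ M.D₁ M.D₂) :=
    (WithLp.prodContinuousLinearEquiv 2 ℂ M.D₁ M.D₂).surjective.denseRange
  exact h2.comp (h1.comp h3 (M.I₁.prodMap M.I₂).continuous)
    (WithLp.prodContinuousLinearEquiv 2 ℂ H₁ H₂).symm.continuous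

theorem graph_angularExtension :
    M.angularExtension.graph = bulletGraph M.I (conjOp M.I) M.A :=
  bullet_graph M.I_injective (conjOp_injective M.denseRange_I) _

/-- The angular extension is an extension of the original operator matrix. -/
theorem mem_graph_angularExtension (y : M.T₁₁.domain) (z : M.T₂₂.domain) :
    ((WithLp.toLp 2 ((y : H₁), (z : H₂)), WithLp.toLp 2 (M.T₁₁ y + M.T₁₂ z, M.T₂₁ y + M.T₂₂ z)) :
      WithLp 2 (H₁ × H₂) × WithLp 2 (H₁ × H₂)) ∈ M.angularExtension.graph := by
  rw [graph_angularExtension]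
  refine ⟨WithLp.toLp 2 (M.ι₁ y, M.ι₂ z), ?_, ?_⟩
  · rw [I_apply]
    simp [I₁_ι, I₂_ι]
  · ext w
    rw [A_apply, conjOp_apply, I_apply, WithLp.prod_inner_apply]
    change M.A₁₁ (M.ι₁ y) w.fst + M.A₁₂ (M.ι₂ z) w.fst +
      (M.A₂₁ (M.ι₁ y) w.snd + M.A₂₂ (M.ι₂ z) w.snd) = _
    simp only [A₁₁_ι, A₁₂_ι, A₂₁_ι, A₂₂_ι, conjOp_apply, inner_add_right]

end BlockMatrix

end

set_option linter.unusedSectionVars false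

noncomputable section

open scoped InnerProductSpace

/-! ## Hermitian forms that are positive up to finite dimension -/

/-! By the Riesz isomorphism, `S t` becomes a bounded self-adjoint operator `schur t` in the Hilbert
space `D₁`. The same is done for `T - t` and `T₂₂ - t` (`pencil`, `pencil₂`), and for `t` in the
resolvent set of the Friedrichs extension `pencil₂ t` is invertible. Eliminating the second
component (`pencil_apply_eq_iff`) shows that the kernel of `schur t` is isomorphic to the eigenspace
of the angular extension at `t`, and that `t` is a resolvent point as soon as `schur t` is
invertible. The theorem is thus a statement about the zeros of the family `schur t`.

This family is norm continuous, and its quadratic form is strictly decreasing in `t`: the derivative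
at `x` is `-(‖I₁ x‖² + ‖I₂ u‖²)` with `u = pencil₂⁻¹ G x`, and `I₁` is injective. Compactness makes
the form at the right endpoint uniformly positive off a finite-dimensional subspace, and
monotonicity carries this to all smaller `t`. An operator `F` with this property splits the space
into a finite-dimensional negative part, a finite-dimensional kernel and a uniformly positive part,
with the two definite parts `F`-orthogonal (`IsEssentiallyPositive.nonempty_inertiaDecomposition`).
In particular `F` is invertible once its kernel is trivial.

Let `N t` be the negative index and `k t` the dimension of the kernel. Strict decrease gives `N s +
k s ≤ N t` for `s < t`; stability of the definite parts under small perturbations gives `N t ≤ N s ≤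
N t + k t` for `s` near `t`. Hence `N` is an integer step function that is continuous from the left
and rises by `k t` immediately to the right of `t`. So the zeros are isolated, and summing the jumps
over `[a, b)` gives `N b - N a` (`exists_finset_sum_jumps`).

The second assertion is the first one for the reflected family `-schur (-t)`, which turns `(a, b]`
into `[-b, -a)`. -/

theorem Submodule.rank_le_of_sup_eq_top_of_disjoint {K V : Type*} [Field K] [AddCommGroup V]
    [Module K V] {M N W : Submodule K V} (h : N ⊔ W = ⊤) (h' : Disjoint M W) :
    Module.rank K M ≤ Module.rank K N := by
  -- The quotient by `W` mediates: `M` embeds into it and `N` maps onto it.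
  have h1 : Module.rank K M ≤ Module.rank K (V ⧸ W) := by
    refine LinearMap.rank_le_of_injective (W.mkQ ∘ₗ M.subtype) ?_
    refine (injective_iff_map_eq_zero _).2 fun x hx => ?_
    have hx' : (x : V) ∈ W := by simpa using hx
    exact Subtype.ext (Submodule.disjoint_def.1 h' x x.2 hx')
  have h2 : Module.rank K (V ⧸ W) ≤ Module.rank K N := by
    refine LinearMap.rank_le_of_surjective (W.mkQ ∘ₗ N.subtype) fun q => ?_
    obtain ⟨v, rfl⟩ := W.mkQ_surjective q
    have hv : v ∈ N ⊔ W := h ▸ Submodule.mem_top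
    obtain ⟨n, hn, w, hw, rfl⟩ := Submodule.mem_sup.1 hv
    refine ⟨⟨n, hn⟩, ?_⟩
    simpa [Submodule.Quotient.eq] using hw
  exact h1.trans h2

/-- Diagonalize: `M` and `P` are spanned by the eigenvectors with negative and positive eigenvalues,
and `δ` is a lower bound for the moduli of the nonzero eigenvalues. -/
theorem LinearMap.IsSymmetric.exists_inertia_decomposition {L : Type*} [NormedAddCommGroup L]
    [InnerProductSpace ℂ L] [FiniteDimensional ℂ L] {T : L →ₗ[ℂ] L} (hT : T.IsSymmetric) :
    ∃ (M P : Submodule ℂ L) (δ : ℝ), 0 < δ ∧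
      (∀ x ∈ M, (⟪x, T x⟫_ℂ).re ≤ -(δ * ‖x‖ ^ 2)) ∧
      (∀ x ∈ P, δ * ‖x‖ ^ 2 ≤ (⟪x, T x⟫_ℂ).re) ∧
      (∀ x ∈ M, ∀ y ∈ P, ⟪x, T y⟫_ℂ = 0) ∧ M ⊔ LinearMap.ker T ⊔ P = ⊤ := by
  set e := hT.eigenvectorBasis rfl with he
  set l := hT.eigenvalues rfl with hl
  -- Every sufficiently small `δ` works because there are finitely many eigenvalues; this also
  -- covers the case that all of them vanish, where a minimum would be over the empty set.
  have hδ : ∃ δ > 0, ∀ i, l i ≠ 0 → δ ≤ |l i| := by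
    have h : ∀ᶠ δ in nhdsWithin (0 : ℝ) (Set.Ioi 0), ∀ i, l i ≠ 0 → δ ≤ |l i| := by
      refine Filter.eventually_all.2 fun i => ?_
      by_cases hi : l i = 0
      · simp [hi]
      · filter_upwards [Ioo_mem_nhdsGT (abs_pos.2 hi)] with δ hδ _ using hδ.2.le
    obtain ⟨δ, h1, h2⟩ := (h.and self_mem_nhdsWithin).exists
    exact ⟨δ, h2, h1⟩
  obtain ⟨δ, hδ0, hδ⟩ := hδ
  have hTe : ∀ x i, e.repr (T x) i = l i * e.repr x i := fun x i =>
    hT.eigenvectorBasis_apply_self_apply rfl x i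
  have hin : ∀ x y, ⟪x, T y⟫_ℂ = ∑ i, (l i : ℂ) * (e.repr y i * starRingEnd ℂ (e.repr x i)) := by
    intro x y
    rw [← e.repr.inner_map_map, PiLp.inner_apply]
    refine Finset.sum_congr rfl fun i _ => ?_
    rw [RCLike.inner_apply, hTe]
    ring
  have hre : ∀ x, (⟪x, T x⟫_ℂ).re = ∑ i, l i * ‖e.repr x i‖ ^ 2 := by
    intro x
    rw [hin, Complex.re_sum]
    refine Finset.sum_congr rfl fun i _ => ?_
    rw [Complex.mul_conj, Complex.normSq_eq_norm_sq, ← Complex.ofReal_mul, Complex.ofReal_re]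
  have hnorm : ∀ x, ‖x‖ ^ 2 = ∑ i, ‖e.repr x i‖ ^ 2 := by
    intro x
    rw [← e.repr.norm_map, EuclideanSpace.norm_sq_eq]
  -- `C p` is the span of the eigenvectors whose eigenvalue satisfies `p`, described by the
  -- vanishing of the other coordinates.
  let C : (ℝ → Prop) → Submodule ℂ L := fun p =>
    { carrier := {x | ∀ i, ¬ p (l i) → e.repr x i = 0}
      zero_mem' := by simp
      add_mem' := by
        intro x y hx hy i hi
        simp [hx i hi, hy i hi]
      smul_mem' := by
        intro a x hx i hi
        simp [hx i hi] }
  have hC : ∀ p x, x ∈ C p ↔ ∀ i, ¬ p (l i) → e.repr x i = 0 := fun _ _ => Iff.rfl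
  refine ⟨C (· < 0), C (0 < ·), δ, hδ0, ?_, ?_, ?_, ?_⟩
  · intro x hx
    rw [hre, hnorm, Finset.mul_sum, ← Finset.sum_neg_distrib]
    refine Finset.sum_le_sum fun i _ => ?_
    by_cases hi : l i < 0
    · have := hδ i hi.ne
      rw [abs_of_neg hi] at this
      nlinarith [sq_nonneg ‖e.repr x i‖]
    · simp [hx i hi]
  · intro x hx
    rw [hre, hnorm, Finset.mul_sum]
    refine Finset.sum_le_sum fun i _ => ?_
    by_cases hi : 0 < l i
    · have := hδ i hi.ne'
      rw [abs_of_pos hi] at this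
      nlinarith [sq_nonneg ‖e.repr x i‖]
    · simp [hx i hi]
  · intro x hx y hy
    rw [hin]
    refine Finset.sum_eq_zero fun i _ => ?_
    by_cases hi : l i < 0
    · rw [hy i hi.le.not_gt]
      simp
    · rw [hx i hi]
      simp
  · refine eq_top_iff.2 fun x _ => ?_
    classical
    let pr : (ℝ → Prop) → L := fun p =>
      e.repr.symm (WithLp.toLp 2 fun i => if p (l i) then e.repr x i else 0)
    have hpr : ∀ p i, p (l i) → e.repr (pr p) i = e.repr x i := by
      intro p i hi
      simp [pr, hi]
    have hpr' : ∀ p i, ¬ p (l i) → e.repr (pr p) i = 0 := by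
      intro p i hi
      simp [pr, hi]
    have hsum : x = pr (· < 0) + pr (· = 0) + pr (0 < ·) := by
      refine e.repr.injective ?_
      ext i
      simp only [map_add, PiLp.add_apply]
      rcases lt_trichotomy (l i) 0 with h | h | h
      · rw [hpr (· < 0) i h, hpr' (· = 0) i h.ne, hpr' (0 < ·) i h.le.not_gt, add_zero, add_zero]
      · rw [hpr' (· < 0) i h.not_lt, hpr (· = 0) i h, hpr' (0 < ·) i h.not_gt, zero_add, add_zero]
      · rw [hpr' (· < 0) i h.le.not_gt, hpr' (· = 0) i h.ne', hpr (0 < ·) i h, zero_add, zero_add]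
    rw [hsum]
    refine Submodule.add_mem_sup (Submodule.add_mem_sup ?_ ?_) ?_
    · exact (hC (· < 0) _).2 fun i hi => hpr' (· < 0) i hi
    · refine LinearMap.mem_ker.2 (e.repr.injective ?_)
      ext i
      rw [hTe]
      by_cases h : l i = 0
      · simp [h]
      · rw [hpr' (· = 0) i h]
        simp
    · exact (hC (0 < ·) _).2 fun i hi => hpr' (0 < ·) i hi

section Inertia

variable {E : Type*} [NormedAddCommGroup E] [InnerProductSpace ℂ E] [CompleteSpace E]

/-- The quadratic form of `F` is uniformly positive on the orthogonal complement of a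
finite-dimensional subspace. -/
def IsEssentiallyPositive (F : E →L[ℂ] E) : Prop :=
  ∃ ε > 0, ∃ Z : Submodule ℂ E, FiniteDimensional ℂ Z ∧
    ∀ x ∈ Zᗮ, ε * ‖x‖ ^ 2 ≤ (⟪x, F x⟫_ℂ).re

theorem IsEssentiallyPositive.mono {F G : E →L[ℂ] E} (hF : IsEssentiallyPositive F)
    (h : ∀ x, (⟪x, F x⟫_ℂ).re ≤ (⟪x, G x⟫_ℂ).re) : IsEssentiallyPositive G := by
  obtain ⟨ε, hε, Z, hZ, hF⟩ := hF
  exact ⟨ε, hε, Z, hZ, fun x hx => (hF x hx).trans (h x)⟩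

/-- A splitting of the space into a finite-dimensional subspace where the form of `F` is uniformly
negative, the kernel of `F`, and a subspace where the form is uniformly positive. -/
structure InertiaDecomposition (F : E →L[ℂ] E) where
  /-- the negative subspace -/
  neg : Submodule ℂ E
  /-- the positive subspace -/
  pos : Submodule ℂ E
  /-- the common bound -/
  δ : ℝ
  δ_pos : 0 < δ
  finite_neg : FiniteDimensional ℂ neg
  finite_ker : FiniteDimensional ℂ (LinearMap.ker F.toLinearMap)
  neg_le : ∀ x ∈ neg, (⟪x, F x⟫_ℂ).re ≤ -(δ * ‖x‖ ^ 2)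
  le_pos : ∀ x ∈ pos, δ * ‖x‖ ^ 2 ≤ (⟪x, F x⟫_ℂ).re
  inner_eq_zero : ∀ x ∈ neg, ∀ y ∈ pos, ⟪x, F y⟫_ℂ = 0
  sup_eq_top : neg ⊔ LinearMap.ker F.toLinearMap ⊔ pos = ⊤

theorem IsSelfAdjoint.inner_map_comm {F : E →L[ℂ] E} (hF : IsSelfAdjoint F) (x y : E) :
    ⟪x, F y⟫_ℂ = ⟪F x, y⟫_ℂ := (hF.isSymmetric x y).symm

/-- The `F`-orthogonal complement of `Zᗮ` is `L = {x | F x ∈ Z}`. Coercivity on `Zᗮ` makes `E` the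
direct sum of `L` and `Zᗮ`, so `dim L ≤ dim Z`, and the problem reduces to the finite-dimensional
compression of `F` to `L`, which has the same kernel as `F`. -/
theorem IsEssentiallyPositive.nonempty_inertiaDecomposition {F : E →L[ℂ] E}
    (hF : IsEssentiallyPositive F) (hs : IsSelfAdjoint F) : Nonempty (InertiaDecomposition F) := by
  obtain ⟨ε, hε, Z, hZ, hpos⟩ := hF
  have hZZ : Zᗮᗮ = Z := Submodule.orthogonal_orthogonal Z
  have hZtop : Z ⊔ Zᗮ = ⊤ := Submodule.sup_orthogonal_of_hasOrthogonalProjection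
  set G : Zᗮ →L[ℂ] Zᗮ := Zᗮ.orthogonalProjectionOnto ∘L F ∘L Zᗮ.subtypeL with hG
  have hGin : ∀ x y : Zᗮ, ⟪x, G y⟫_ℂ = ⟪(x : E), F y⟫_ℂ := fun x y => by
    simp [hG]
  -- Lax–Milgram for the compression of `F` to `Zᗮ`.
  have hGu : IsUnit G := by
    refine ContinuousLinearMap.isUnit_of_forall_le_norm_inner_map G (c := ⟨ε, hε.le⟩) hε fun x => ?_
    have h1 : ⟪G x, x⟫_ℂ = starRingEnd ℂ ⟪(x : E), F x⟫_ℂ := by rw [← hGin, inner_conj_symm]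
    rw [h1, RCLike.norm_conj]
    have := (hpos x x.2).trans ((le_abs_self _).trans (Complex.abs_re_le_norm _))
    rw [mul_comm]
    exact this
  set L : Submodule ℂ E := Z.comap F.toLinearMap with hL
  have hdis : Disjoint L Zᗮ := by
    refine Submodule.disjoint_def.2 fun x hx hx' => ?_
    have h0 : ⟪x, F x⟫_ℂ = 0 := Submodule.inner_left_of_mem_orthogonal hx hx'
    have h1 := hpos x hx'
    rw [h0, Complex.zero_re] at h1
    have h2 : ‖x‖ ^ 2 ≤ 0 := by nlinarith [sq_nonneg ‖x‖]
    exact norm_eq_zero.1 ((pow_eq_zero_iff two_ne_zero).1 (le_antisymm h2 (sq_nonneg _)))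
  have hfin : FiniteDimensional ℂ L := by
    refine Module.rank_lt_aleph0_iff.1 ?_
    exact (Submodule.rank_le_of_sup_eq_top_of_disjoint hZtop hdis).trans_lt
      (Module.rank_lt_aleph0_iff.2 hZ)
  have htop : L ⊔ Zᗮ = ⊤ := by
    refine eq_top_iff.2 fun x _ => ?_
    -- Choose `w ∈ Zᗮ` such that `F w` and `F x` have the same projection to `Zᗮ`; then `F (x - w) ∈
    -- Zᗮᗮ = Z`.
    obtain ⟨w, hw⟩ := (ContinuousLinearMap.isUnit_iff_bijective.1 hGu).2
      (Zᗮ.orthogonalProjectionOnto (F x))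
    have hmem : x - w ∈ L := by
      change F (x - w) ∈ Z
      refine hZZ.le ((Submodule.mem_orthogonal _ _).2 fun u hu => ?_)
      have h1 : ⟪(⟨u, hu⟩ : Zᗮ), G w⟫_ℂ = ⟪u, F x⟫_ℂ := by
        rw [hw]
        simp
      rw [hGin] at h1
      rw [map_sub, inner_sub_right, ← h1, sub_self]
    have := Submodule.add_mem_sup hmem w.2
    simpa using this
  set T : L →ₗ[ℂ] L := (L.orthogonalProjectionOnto ∘L F ∘L L.subtypeL).toLinearMap with hT
  have hTin : ∀ x y : L, ⟪x, T y⟫_ℂ = ⟪(x : E), F y⟫_ℂ := fun x y => by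
    simp [hT]
  have hTs : T.IsSymmetric := fun x y => by
    rw [← inner_conj_symm, hTin, hTin, inner_conj_symm, hs.inner_map_comm]
  have hker : LinearMap.ker F.toLinearMap ≤ L := fun x hx => by
    have : F x = 0 := hx
    change F x ∈ Z
    rw [this]
    exact Z.zero_mem
  -- `F x` is orthogonal to `L` because the compression kills `x`, and to `Zᗮ` because `x ∈ L`;
  -- these two subspaces span `E`.
  have hkerT : ∀ x ∈ LinearMap.ker T, (x : E) ∈ LinearMap.ker F.toLinearMap := fun x hx => by
    change F x = 0
    refine ext_inner_left ℂ fun v => ?_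
    have hv : v ∈ L ⊔ Zᗮ := htop ▸ Submodule.mem_top
    obtain ⟨l, hl, w, hw, rfl⟩ := Submodule.mem_sup.1 hv
    have h1 := hTin ⟨l, hl⟩ x
    rw [LinearMap.mem_ker.1 hx, inner_zero_right] at h1
    have h2 : ⟪w, F x⟫_ℂ = 0 := Submodule.inner_left_of_mem_orthogonal x.2 hw
    rw [inner_add_left, ← h1, h2, add_zero, inner_zero_right]
  obtain ⟨M, P, δ, hδ, hM, hP, hMP, hall⟩ := hTs.exists_inertia_decomposition
  have hcross : ∀ w ∈ Zᗮ, ∀ l ∈ L, ⟪w, F l⟫_ℂ = 0 := fun w hw l hl =>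
    Submodule.inner_left_of_mem_orthogonal hl hw
  have hcross' : ∀ w ∈ Zᗮ, ∀ l ∈ L, ⟪l, F w⟫_ℂ = 0 := fun w hw l hl => by
    rw [hs.inner_map_comm, ← inner_conj_symm, hcross w hw l hl, map_zero]
  -- `P` and `Zᗮ` are orthogonal for the form of `F` but not in `E`, so only `‖p + w‖² ≤ 2 (‖p‖² +
  -- ‖w‖²)` is available; this costs the factor `1 / 2`.
  have hmin : 0 < min δ ε / 2 := by positivity
  refine ⟨⟨M.map L.subtype, P.map L.subtype ⊔ Zᗮ, min δ ε / 2, hmin, inferInstance,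
    Submodule.finiteDimensional_of_le hker, ?_, ?_, ?_, ?_⟩⟩
  · rintro _ ⟨x, hx, rfl⟩
    have h1 := hM x hx
    rw [hTin] at h1
    refine h1.trans (neg_le_neg ?_)
    refine mul_le_mul_of_nonneg_right ?_ (sq_nonneg _)
    linarith [min_le_left δ ε]
  · intro x hx
    obtain ⟨_, ⟨p, hp, rfl⟩, w, hw, rfl⟩ := Submodule.mem_sup.1 hx
    have h1 := hP p hp
    rw [hTin] at h1
    have h2 := hpos w hw
    have h3 : ⟪L.subtype p + w, F (L.subtype p + w)⟫_ℂ = ⟪(p : E), F p⟫_ℂ + ⟪w, F w⟫_ℂ := by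
      rw [map_add, inner_add_left, inner_add_right, inner_add_right]
      have ha := hcross w hw p p.2
      have hb := hcross' w hw p p.2
      simp only [Submodule.subtype_apply]
      rw [ha, hb]
      ring
    rw [h3, Complex.add_re]
    have h4 : ‖L.subtype p + w‖ ≤ ‖p‖ + ‖w‖ := norm_add_le _ _
    have h5 : ‖L.subtype p + w‖ ^ 2 ≤ 2 * (‖p‖ ^ 2 + ‖w‖ ^ 2) := by
      nlinarith [norm_nonneg (L.subtype p + w), sq_nonneg (‖p‖ - ‖w‖)]
    nlinarith [min_le_left δ ε, min_le_right δ ε, sq_nonneg ‖p‖, sq_nonneg ‖w‖]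
  · rintro _ ⟨x, hx, rfl⟩ y hy
    obtain ⟨_, ⟨p, hp, rfl⟩, w, hw, rfl⟩ := Submodule.mem_sup.1 hy
    have h1 := hMP x hx p hp
    rw [hTin] at h1
    rw [map_add, inner_add_right]
    simp only [Submodule.subtype_apply]
    rw [h1, hcross' w hw x x.2, add_zero]
  · refine eq_top_iff.2 fun x _ => ?_
    have hx : x ∈ L ⊔ Zᗮ := htop ▸ Submodule.mem_top
    obtain ⟨l, hl, w, hw, rfl⟩ := Submodule.mem_sup.1 hx
    have hl' : (⟨l, hl⟩ : L) ∈ M ⊔ LinearMap.ker T ⊔ P := hall ▸ Submodule.mem_top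
    obtain ⟨y, hy, p, hp, hyp⟩ := Submodule.mem_sup.1 hl'
    obtain ⟨m, hm, k, hk, rfl⟩ := Submodule.mem_sup.1 hy
    have hlE : l = (m : E) + k + p := (congrArg (Subtype.val) hyp).symm
    rw [hlE, add_assoc]
    exact Submodule.add_mem_sup (Submodule.add_mem_sup ⟨m, hm, rfl⟩ (hkerT k hk))
      (Submodule.add_mem_sup ⟨p, hp, rfl⟩ hw)

end Inertia

/-! ## Jump functions -/

section Jumps

open Filter Topology

variable {a b : ℝ} {N k : ℝ → ℕ}

/-- Chain the jump inequality through the points of `P` in increasing order; the induction removes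
the largest point `q` and uses the bound for the rest at `q`. -/
theorem sum_jumps_le
    (hjump : ∀ s ∈ Set.Icc a b, ∀ t ∈ Set.Icc a b, s < t → N s + k s ≤ N t) (P : Finset ℝ) :
    ∀ t ∈ Set.Icc a b, (∀ p ∈ P, a ≤ p ∧ p < t) → ∑ p ∈ P, k p + N a ≤ N t := by
  induction P using Finset.induction_on_max with
  | empty =>
    intro t ht _
    rcases ht.1.eq_or_lt with h | h
    · simp [h]
    · have := hjump a ⟨le_rfl, ht.1.trans ht.2⟩ t ht h
      simp only [Finset.sum_empty]
      omega
  | insert q P hq ih =>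
    intro t ht hP
    have hqt := hP q (Finset.mem_insert_self _ _)
    have hqm : q ∈ Set.Icc a b := ⟨hqt.1, hqt.2.le.trans ht.2⟩
    rw [Finset.sum_insert fun h => (hq q h).false]
    have h1 := ih q hqm fun p hp => ⟨(hP p (Finset.mem_insert_of_mem hp)).1, hq p hp⟩
    have h2 := hjump q hqm t ht hqt.2
    omega

theorem finite_setOf_jump (hab : a ≤ b)
    (hjump : ∀ s ∈ Set.Icc a b, ∀ t ∈ Set.Icc a b, s < t → N s + k s ≤ N t) :
    {t | t ∈ Set.Ico a b ∧ k t ≠ 0}.Finite := by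
  by_contra hinf
  -- Each such point contributes at least `1` to the sum, which is at most `N b`; one point more is
  -- a contradiction.
  obtain ⟨P, hP, hcard⟩ := Set.Infinite.exists_subset_card_eq hinf (N b + 1)
  have h1 := sum_jumps_le hjump P b ⟨hab, le_rfl⟩ fun p hp => (hP hp).1
  have h2 : P.card ≤ ∑ p ∈ P, k p := by
    rw [Finset.card_eq_sum_ones]
    exact Finset.sum_le_sum fun p hp => Nat.one_le_iff_ne_zero.2 (hP hp).2
  omega

/-- Subtracting from `N` all jumps strictly to the left of `t` leaves a locally constant function on
a connected interval. The strict inequality reflects that a jump at `p` is visible only to the right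
of `p`; hence `a` is counted and `b` is not. -/
theorem exists_finset_sum_jumps (hab : a ≤ b)
    (hjump : ∀ s ∈ Set.Icc a b, ∀ t ∈ Set.Icc a b, s < t → N s + k s ≤ N t)
    (hupper : ∀ t ∈ Set.Icc a b, ∀ᶠ s in 𝓝[Set.Icc a b] t, N s ≤ N t + k t)
    (hlower : ∀ t ∈ Set.Icc a b, ∀ᶠ s in 𝓝[Set.Icc a b] t, N t ≤ N s) :
    ∃ P : Finset ℝ, (P : Set ℝ) ⊆ Set.Ico a b ∧ (∀ t ∈ Set.Ico a b, k t ≠ 0 → t ∈ P) ∧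
      ∑ p ∈ P, k p + N a = N b := by
  set P := (finite_setOf_jump hab hjump).toFinset with hPdef
  have hP : ∀ t, t ∈ P ↔ t ∈ Set.Ico a b ∧ k t ≠ 0 := fun t => by simp [hPdef]
  refine ⟨P, fun t ht => ((hP t).1 ht).1, fun t ht hk => (hP t).2 ⟨ht, hk⟩, ?_⟩
  -- Integer values avoid truncated subtraction, and the discrete target turns continuity into
  -- constancy.
  set f : ℝ → ℤ := fun t => N t - ∑ p ∈ P, if p < t then (k p : ℤ) else 0 with hf
  have hmono : ∀ s ∈ Set.Icc a b, ∀ t ∈ Set.Icc a b, s ≤ t → N s ≤ N t := fun s hs t ht hst => by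
    rcases hst.eq_or_lt with rfl | h
    · exact le_rfl
    · have := hjump s hs t ht h
      omega
  have hcont : ContinuousOn f (Set.Icc a b) := by
    intro t ht
    refine (continuousWithinAt_const (b := f t)).congr_of_eventuallyEq ?_ rfl
    filter_upwards [hupper t ht, hlower t ht, self_mem_nhdsWithin] with s h1 h2 hs
    rcases lt_trichotomy s t with hst | rfl | hst
    · have h3 := hjump s hs t ht hst
      have h4 : ∀ p ∈ P, (if p < s then (k p : ℤ) else 0) = if p < t then (k p : ℤ) else 0 := by
        intro p hp
        by_cases hps : p < s
        · rw [if_pos hps, if_pos (hps.trans hst)]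
        · by_cases hpt : p < t
          · have hpm : p ∈ Set.Icc a b := ⟨hs.1.trans (not_lt.1 hps), hpt.le.trans ht.2⟩
            have h5 := hjump p hpm t ht hpt
            have h6 := hmono s hs p hpm (not_lt.1 hps)
            -- To the left of `t` nothing may jump: `N p + k p ≤ N t ≤ N s ≤ N p`.
            have h7 : k p = 0 := by omega
            simp [h7]
          · rw [if_neg hps, if_neg hpt]
      simp only [hf]
      rw [Finset.sum_congr rfl h4]
      omega
    · rfl
    · have h3 := hjump t ht s hs hst
      have h4 : ∀ p ∈ P, (if p < s then (k p : ℤ) else 0) =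
          (if p < t then (k p : ℤ) else 0) + if t = p then (k p : ℤ) else 0 := by
        intro p hp
        rcases lt_trichotomy p t with hpt | rfl | hpt
        · rw [if_pos (hpt.trans hst), if_pos hpt, if_neg hpt.ne', add_zero]
        · simp [hst]
        · by_cases hps : p < s
          · have hpm : p ∈ Set.Icc a b := ⟨ht.1.trans hpt.le, hps.le.trans hs.2⟩
            have h5 := hjump p hpm s hs hps
            have h6 := hjump t ht p hpm hpt
            -- To the right of `t` the jump at `t` uses up the whole increase: `N t + k t + k p ≤ N
            -- p + k p ≤ N s ≤ N t + k t`.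
            have h7 : k p = 0 := by omega
            simp [h7]
          · rw [if_neg hps, if_neg hpt.le.not_gt, if_neg hpt.ne, add_zero]
      have h5 : (∑ p ∈ P, if t = p then (k p : ℤ) else 0) = k t := by
        rw [Finset.sum_ite_eq]
        by_cases htP : t ∈ P
        · rw [if_pos htP]
        · rw [if_neg htP]
          by_contra hk
          exact htP ((hP t).2 ⟨⟨ht.1, hst.trans_le hs.2⟩, fun h0 => hk (by simp [h0])⟩)
      simp only [hf]
      rw [Finset.sum_congr rfl h4, Finset.sum_add_distrib, h5]
      omega
  have hconst := isPreconnected_Icc.constant hcont (Set.left_mem_Icc.2 hab)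
    (Set.right_mem_Icc.2 hab)
  simp only [hf] at hconst
  rw [Finset.sum_eq_zero (f := fun p => if p < a then (k p : ℤ) else 0) fun p hp =>
      if_neg ((hP p).1 hp).1.1.not_gt,
    Finset.sum_congr (g := fun p => (k p : ℤ)) rfl fun p hp => if_pos ((hP p).1 hp).1.2] at hconst
  zify
  linarith

theorem eventually_jump_eq_zero
    (hjump : ∀ s ∈ Set.Icc a b, ∀ t ∈ Set.Icc a b, s < t → N s + k s ≤ N t)
    (hupper : ∀ t ∈ Set.Icc a b, ∀ᶠ s in 𝓝[Set.Icc a b] t, N s ≤ N t + k t)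
    (hlower : ∀ t ∈ Set.Icc a b, ∀ᶠ s in 𝓝[Set.Icc a b] t, N t ≤ N s)
    {t : ℝ} (ht : t ∈ Set.Ioo a b) : ∀ᶠ s in 𝓝[≠] t, k s = 0 := by
  have htI : t ∈ Set.Icc a b := ⟨ht.1.le, ht.2.le⟩
  have hn : 𝓝[Set.Icc a b] t = 𝓝 t := nhdsWithin_eq_nhds.2 (Icc_mem_nhds ht.1 ht.2)
  have hu := hupper t htI
  have hl := hlower t htI
  rw [hn] at hu hl
  -- For `s` to the right of `t`, a point `r` beyond `s` is needed to detect a jump at `s`.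
  have hr : ∃ r, t < r ∧ r < b ∧ N r ≤ N t + k t := by
    have h1 : ∀ᶠ s in 𝓝[>] t, N s ≤ N t + k t := nhdsWithin_le_nhds hu
    obtain ⟨r, hr1, hr2⟩ := (h1.and (Ioo_mem_nhdsGT ht.2)).exists
    exact ⟨r, hr2.1, hr2.2, hr1⟩
  obtain ⟨r, htr, hrb, hr⟩ := hr
  filter_upwards [nhdsWithin_le_nhds hl, nhdsWithin_le_nhds (Ioo_mem_nhds ht.1 htr),
    self_mem_nhdsWithin] with s hs1 hs2 hs3
  have hsI : s ∈ Set.Icc a b := ⟨hs2.1.le, hs2.2.le.trans hrb.le⟩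
  have hrI : r ∈ Set.Icc a b := ⟨(hs2.1.trans hs2.2).le, hrb.le⟩
  rcases lt_or_gt_of_ne hs3 with h | h
  · have := hjump s hsI t htI h
    omega
  · have h1 := hjump s hsI r hrI hs2.2
    have h2 := hjump t htI s hsI h
    omega

end Jumps

/-! ## The negative index of inertia -/

section Inertia

open Filter Topology

variable {E : Type*} [NormedAddCommGroup E] [InnerProductSpace ℂ E] [CompleteSpace E]

/-- The negative index of inertia of the quadratic form `⟪x, F x⟫`. -/
def operatorNegIndex (F : E →L[ℂ] E) : ℕ∞ := negIndex (innerSLFlip ℂ ∘L F)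

theorem operatorNegIndex_le {F : E →L[ℂ] E} {n : ℕ∞}
    (h : ∀ M : Submodule ℂ E, (∀ y ∈ M, y ≠ 0 → (⟪y, F y⟫_ℂ).re < 0) →
      Cardinal.toENat (Module.rank ℂ M) ≤ n) : operatorNegIndex F ≤ n :=
  iSup₂_le h

theorem le_operatorNegIndex {F : E →L[ℂ] E} (M : Submodule ℂ E) [FiniteDimensional ℂ M]
    (h : ∀ y ∈ M, y ≠ 0 → (⟪y, F y⟫_ℂ).re < 0) :
    (Module.finrank ℂ M : ℕ∞) ≤ operatorNegIndex F := by
  have h1 : Cardinal.toENat (Module.rank ℂ M) ≤ operatorNegIndex F := le_iSup₂_of_le M h le_rfl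
  rwa [← Module.finrank_eq_rank, Cardinal.toENat_nat] at h1

/-- A subspace on which the form is negative meets `W` only in zero, so its dimension is at most the
codimension of `W`. -/
theorem operatorNegIndex_le_finrank {F : E →L[ℂ] E} (V W : Submodule ℂ E) [FiniteDimensional ℂ V]
    (hVW : V ⊔ W = ⊤) (hW : ∀ x ∈ W, 0 ≤ (⟪x, F x⟫_ℂ).re) :
    operatorNegIndex F ≤ Module.finrank ℂ V := by
  refine operatorNegIndex_le fun M hM => ?_
  have hd : Disjoint M W := Submodule.disjoint_def.2 fun x hx hx' => by
    by_contra h0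
    exact (hM x hx h0).not_ge (hW x hx')
  have h := Submodule.rank_le_of_sup_eq_top_of_disjoint hVW hd
  rw [← Module.finrank_eq_rank ℂ V] at h
  exact Cardinal.toENat_le_natCast.2 h

namespace InertiaDecomposition

variable {F : E →L[ℂ] E} (d : InertiaDecomposition F)

theorem neg_lt {x : E} (hx : x ∈ d.neg) (h0 : x ≠ 0) : (⟪x, F x⟫_ℂ).re < 0 := by
  have h1 := d.neg_le x hx
  have := mul_pos d.δ_pos (pow_pos (norm_pos_iff.2 h0) 2)
  linarith

instance : FiniteDimensional ℂ d.neg := d.finite_neg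

theorem disjoint_neg_ker : Disjoint d.neg (LinearMap.ker F.toLinearMap) :=
  Submodule.disjoint_def.2 fun x hx hx' => by
    by_contra h0
    have h1 := d.neg_lt hx h0
    have h2 : F x = 0 := hx'
    rw [h2, inner_zero_right, Complex.zero_re] at h1
    exact h1.false

theorem inner_add_ker (hs : IsSelfAdjoint F) {x k : E} (hk : k ∈ LinearMap.ker F.toLinearMap) :
    ⟪x + k, F (x + k)⟫_ℂ = ⟪x, F x⟫_ℂ := by
  have h2 : F k = 0 := hk
  rw [map_add, h2, add_zero, inner_add_left, hs.inner_map_comm k x, h2, inner_zero_left, add_zero]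

theorem operatorNegIndex_eq (hs : IsSelfAdjoint F) :
    operatorNegIndex F = Module.finrank ℂ d.neg := by
  refine le_antisymm ?_ (le_operatorNegIndex d.neg fun y hy h0 => d.neg_lt hy h0)
  refine operatorNegIndex_le_finrank d.neg (LinearMap.ker F.toLinearMap ⊔ d.pos) ?_ ?_
  · rw [← sup_assoc, d.sup_eq_top]
  · intro x hx
    rw [sup_comm] at hx
    obtain ⟨w, hw, k, hk, rfl⟩ := Submodule.mem_sup.1 hx
    rw [inner_add_ker hs hk]
    have := d.le_pos w hw
    have := mul_nonneg d.δ_pos.le (sq_nonneg ‖w‖)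
    linarith

theorem finite_sup : FiniteDimensional ℂ ↥(d.neg ⊔ LinearMap.ker F.toLinearMap) :=
  have := d.finite_ker
  inferInstance

theorem finrank_sup : Module.finrank ℂ ↥(d.neg ⊔ LinearMap.ker F.toLinearMap) =
    Module.finrank ℂ d.neg + Module.finrank ℂ (LinearMap.ker F.toLinearMap) := by
  have := d.finite_ker
  have h := Submodule.finrank_sup_add_finrank_inf_eq d.neg (LinearMap.ker F.toLinearMap)
  rw [d.disjoint_neg_ker.eq_bot, finrank_bot, add_zero] at h
  exact h

theorem re_inner_sub_le {G : E →L[ℂ] E} (h : ‖G - F‖ ≤ d.δ / 2) (x : E) :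
    |(⟪x, G x⟫_ℂ).re - (⟪x, F x⟫_ℂ).re| ≤ d.δ / 2 * ‖x‖ ^ 2 := by
  have h1 : (⟪x, G x⟫_ℂ).re - (⟪x, F x⟫_ℂ).re = (⟪x, (G - F) x⟫_ℂ).re := by
    rw [sub_apply, inner_sub_right, Complex.sub_re]
  rw [h1]
  calc _ ≤ ‖⟪x, (G - F) x⟫_ℂ‖ := Complex.abs_re_le_norm _
    _ ≤ ‖x‖ * ‖(G - F) x‖ := norm_inner_le_norm _ _
    _ ≤ ‖x‖ * (d.δ / 2 * ‖x‖) := by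
      gcongr
      exact (G - F).le_of_opNorm_le h x
    _ = _ := by ring

/-- The perturbed form is still nonnegative on `d.pos`, whose codimension is at most the right-hand
side. -/
theorem operatorNegIndex_le_of_norm_sub_le {G : E →L[ℂ] E} (h : ‖G - F‖ ≤ d.δ / 2) :
    operatorNegIndex G ≤
      (Module.finrank ℂ d.neg + Module.finrank ℂ (LinearMap.ker F.toLinearMap) : ℕ) := by
  have := d.finite_sup
  rw [← d.finrank_sup]
  refine operatorNegIndex_le_finrank _ d.pos d.sup_eq_top fun x hx => ?_
  have h1 := (abs_le.1 (d.re_inner_sub_le h x)).1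
  have h2 := d.le_pos x hx
  have h3 := mul_nonneg d.δ_pos.le (sq_nonneg ‖x‖)
  linarith

theorem finrank_neg_le_of_norm_sub_le {G : E →L[ℂ] E} (h : ‖G - F‖ ≤ d.δ / 2) :
    (Module.finrank ℂ d.neg : ℕ∞) ≤ operatorNegIndex G := by
  refine le_operatorNegIndex _ fun x hx h0 => ?_
  have h1 := (abs_le.1 (d.re_inner_sub_le h x)).2
  have h2 := d.neg_le x hx
  have h3 := mul_pos d.δ_pos (pow_pos (norm_pos_iff.2 h0) 2)
  linarith

/-- On `d.neg` plus the kernel the form of `F` is nonpositive, so a strictly smaller form is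
negative definite there. This is where the kernel enters the index. -/
theorem finrank_add_le (hs : IsSelfAdjoint F) {G : E →L[ℂ] E}
    (h : ∀ x ≠ 0, (⟪x, G x⟫_ℂ).re < (⟪x, F x⟫_ℂ).re) :
    ((Module.finrank ℂ d.neg + Module.finrank ℂ (LinearMap.ker F.toLinearMap) : ℕ) : ℕ∞) ≤
      operatorNegIndex G := by
  have := d.finite_sup
  rw [← d.finrank_sup]
  refine le_operatorNegIndex _ fun x hx h0 => (h x h0).trans_le ?_
  obtain ⟨m, hm, k, hk, rfl⟩ := Submodule.mem_sup.1 hx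
  rw [inner_add_ker hs hk]
  have h1 := d.neg_le m hm
  have h3 := mul_nonneg d.δ_pos.le (sq_nonneg ‖m‖)
  linarith

/-- Without a kernel, `F` is bounded below on `d.neg ⊔ d.pos = ⊤`; self-adjointness makes its range
dense. -/
theorem isUnit {F : E →L[ℂ] E} (d : InertiaDecomposition F) (hs : IsSelfAdjoint F)
    (hker : LinearMap.ker F.toLinearMap = ⊥) : IsUnit F := by
  have hbound : ∀ x, d.δ / 2 * ‖x‖ ≤ ‖F x‖ := by
    intro x
    have hx : x ∈ d.neg ⊔ d.pos := by
      have := d.sup_eq_top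
      rw [hker, sup_bot_eq] at this
      exact this ▸ Submodule.mem_top
    obtain ⟨m, hm, w, hw, rfl⟩ := Submodule.mem_sup.1 hx
    -- Testing with the sign of `m` flipped makes both definite parts contribute positively; the
    -- mixed terms vanish by `F`-orthogonality.
    have h1 : (⟪w - m, F (m + w)⟫_ℂ).re = (⟪w, F w⟫_ℂ).re - (⟪m, F m⟫_ℂ).re := by
      have h2 := d.inner_eq_zero m hm w hw
      have h3 : ⟪w, F m⟫_ℂ = 0 := by
        rw [hs.inner_map_comm, ← inner_conj_symm, h2, map_zero]
      rw [map_add, inner_sub_left, inner_add_right, inner_add_right, h2, h3]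
      simp
    have h4 : (⟪w - m, F (m + w)⟫_ℂ).re ≤ (‖w‖ + ‖m‖) * ‖F (m + w)‖ :=
      (Complex.re_le_norm _).trans ((norm_inner_le_norm _ _).trans
        (mul_le_mul_of_nonneg_right (norm_sub_le _ _) (norm_nonneg _)))
    have h5 := d.neg_le m hm
    have h6 := d.le_pos w hw
    have h7 : ‖m + w‖ ≤ ‖w‖ + ‖m‖ := (norm_add_le _ _).trans_eq (add_comm _ _)
    have h8 : d.δ / 2 * (‖w‖ + ‖m‖) ^ 2 ≤ (‖w‖ + ‖m‖) * ‖F (m + w)‖ := by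
      have := mul_nonneg d.δ_pos.le (sq_nonneg (‖w‖ - ‖m‖))
      nlinarith
    rcases (add_nonneg (norm_nonneg w) (norm_nonneg m)).eq_or_lt with h0 | h0
    · rw [← h0] at h7
      have : ‖m + w‖ = 0 := le_antisymm h7 (norm_nonneg _)
      rw [this, mul_zero]
      exact norm_nonneg _
    · have h9 : d.δ / 2 * (‖w‖ + ‖m‖) ≤ ‖F (m + w)‖ := by
        refine le_of_mul_le_mul_left ?_ h0
        linarith
      refine le_trans ?_ h9
      exact mul_le_mul_of_nonneg_left h7 (half_pos d.δ_pos).le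
  have hanti : AntilipschitzWith (Real.toNNReal (d.δ / 2))⁻¹ F := by
    refine F.antilipschitz_of_bound fun x => ?_
    have h1 := hbound x
    rw [NNReal.coe_inv, Real.coe_toNNReal _ (half_pos d.δ_pos).le]
    rw [inv_mul_eq_div, le_div_iff₀ (half_pos d.δ_pos)]
    linarith
  rw [ContinuousLinearMap.isUnit_iff_bijective,
    ContinuousLinearMap.bijective_iff_dense_range_and_antilipschitz]
  refine ⟨?_, _, hanti⟩
  rw [Submodule.topologicalClosure_eq_top_iff, hs.isSymmetric.orthogonal_range, hker]

end InertiaDecomposition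

end Inertia

/-! ## Strictly decreasing families of self-adjoint operators -/

section Families

open Filter Topology

variable {E : Type*} [NormedAddCommGroup E] [InnerProductSpace ℂ E] [CompleteSpace E]

/-- A norm-continuous family of self-adjoint operators with strictly decreasing quadratic forms
that are positive up to finite dimension. -/
structure IsDecreasingFamily (F : ℝ → E →L[ℂ] E) (a b : ℝ) : Prop where
  isSelfAdjoint : ∀ t ∈ Set.Icc a b, IsSelfAdjoint (F t)
  continuousOn : ContinuousOn F (Set.Icc a b)
  decreasing : ∀ s ∈ Set.Icc a b, ∀ t ∈ Set.Icc a b, s < t → ∀ x ≠ 0,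
    (⟪x, F t x⟫_ℂ).re < (⟪x, F s x⟫_ℂ).re
  isEssentiallyPositive : IsEssentiallyPositive (F b)

namespace IsDecreasingFamily

variable {F : ℝ → E →L[ℂ] E} {a b : ℝ}

theorem nonempty_inertiaDecomposition (hF : IsDecreasingFamily F a b) {t : ℝ}
    (ht : t ∈ Set.Icc a b) : Nonempty (InertiaDecomposition (F t)) := by
  refine IsEssentiallyPositive.nonempty_inertiaDecomposition ?_ (hF.isSelfAdjoint t ht)
  refine hF.isEssentiallyPositive.mono fun x => ?_
  rcases ht.2.eq_or_lt with rfl | h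
  · exact le_rfl
  · rcases eq_or_ne x 0 with rfl | hx
    · simp
    · exact (hF.decreasing t ht b ⟨ht.1.trans ht.2, le_rfl⟩ h x hx).le

theorem finiteDimensional_ker (hF : IsDecreasingFamily F a b) {t : ℝ} (ht : t ∈ Set.Icc a b) :
    FiniteDimensional ℂ (LinearMap.ker (F t).toLinearMap) :=
  (hF.nonempty_inertiaDecomposition ht).some.finite_ker

theorem isUnit (hF : IsDecreasingFamily F a b) {t : ℝ} (ht : t ∈ Set.Icc a b)
    (h : LinearMap.ker (F t).toLinearMap = ⊥) : IsUnit (F t) :=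
  (hF.nonempty_inertiaDecomposition ht).some.isUnit (hF.isSelfAdjoint t ht) h

theorem operatorNegIndex_ne_top (hF : IsDecreasingFamily F a b) {t : ℝ} (ht : t ∈ Set.Icc a b) :
    operatorNegIndex (F t) ≠ ⊤ := by
  rw [(hF.nonempty_inertiaDecomposition ht).some.operatorNegIndex_eq (hF.isSelfAdjoint t ht)]
  exact ENat.natCast_ne_top _

theorem coe_toNat_operatorNegIndex (hF : IsDecreasingFamily F a b) {t : ℝ}
    (ht : t ∈ Set.Icc a b) : ((operatorNegIndex (F t)).toNat : ℕ∞) = operatorNegIndex (F t) :=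
  ENat.natCast_toNat (hF.operatorNegIndex_ne_top ht)

theorem toNat_operatorNegIndex (hF : IsDecreasingFamily F a b) {t : ℝ} (ht : t ∈ Set.Icc a b)
    (d : InertiaDecomposition (F t)) :
    (operatorNegIndex (F t)).toNat = Module.finrank ℂ d.neg := by
  rw [d.operatorNegIndex_eq (hF.isSelfAdjoint t ht), ENat.toNat_natCast]

theorem jump_le (hF : IsDecreasingFamily F a b) : ∀ s ∈ Set.Icc a b, ∀ t ∈ Set.Icc a b, s < t →
    (operatorNegIndex (F s)).toNat + Module.finrank ℂ (LinearMap.ker (F s).toLinearMap) ≤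
      (operatorNegIndex (F t)).toNat := by
  intro s hs t ht hst
  obtain ⟨d⟩ := hF.nonempty_inertiaDecomposition hs
  rw [hF.toNat_operatorNegIndex hs d, ← Nat.cast_le (α := ℕ∞), hF.coe_toNat_operatorNegIndex ht]
  exact d.finrank_add_le (hF.isSelfAdjoint s hs) (hF.decreasing s hs t ht hst)

theorem eventually_norm_sub_le (hF : IsDecreasingFamily F a b) {t : ℝ} (ht : t ∈ Set.Icc a b)
    {δ : ℝ} (hδ : 0 < δ) : ∀ᶠ s in 𝓝[Set.Icc a b] t, ‖F s - F t‖ ≤ δ := by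
  filter_upwards [(hF.continuousOn t ht).eventually (Metric.closedBall_mem_nhds (F t) hδ)] with s hs
  rwa [← dist_eq_norm]

theorem eventually_le (hF : IsDecreasingFamily F a b) : ∀ t ∈ Set.Icc a b,
    ∀ᶠ s in 𝓝[Set.Icc a b] t, (operatorNegIndex (F s)).toNat ≤
      (operatorNegIndex (F t)).toNat + Module.finrank ℂ (LinearMap.ker (F t).toLinearMap) := by
  intro t ht
  obtain ⟨d⟩ := hF.nonempty_inertiaDecomposition ht
  filter_upwards [hF.eventually_norm_sub_le ht (half_pos d.δ_pos), self_mem_nhdsWithin] with s h hs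
  rw [hF.toNat_operatorNegIndex ht d, ← Nat.cast_le (α := ℕ∞), hF.coe_toNat_operatorNegIndex hs]
  exact d.operatorNegIndex_le_of_norm_sub_le h

theorem eventually_ge (hF : IsDecreasingFamily F a b) : ∀ t ∈ Set.Icc a b,
    ∀ᶠ s in 𝓝[Set.Icc a b] t,
      (operatorNegIndex (F t)).toNat ≤ (operatorNegIndex (F s)).toNat := by
  intro t ht
  obtain ⟨d⟩ := hF.nonempty_inertiaDecomposition ht
  filter_upwards [hF.eventually_norm_sub_le ht (half_pos d.δ_pos), self_mem_nhdsWithin] with s h hs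
  rw [hF.toNat_operatorNegIndex ht d, ← Nat.cast_le (α := ℕ∞), hF.coe_toNat_operatorNegIndex hs]
  exact d.finrank_neg_le_of_norm_sub_le h

theorem eventually_ker_eq_bot (hF : IsDecreasingFamily F a b) {t : ℝ} (ht : t ∈ Set.Ioo a b) :
    ∀ᶠ s in 𝓝[≠] t, LinearMap.ker (F s).toLinearMap = ⊥ := by
  filter_upwards [eventually_jump_eq_zero hF.jump_le hF.eventually_le hF.eventually_ge ht,
    nhdsWithin_le_nhds (Icc_mem_nhds ht.1 ht.2)] with s hs hsI
  have := hF.finiteDimensional_ker hsI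
  exact Submodule.finrank_eq_zero.1 hs

theorem exists_finset_sum_finrank_ker (hF : IsDecreasingFamily F a b) (hab : a ≤ b) :
    ∃ P : Finset ℝ, (P : Set ℝ) ⊆ Set.Ico a b ∧
      (∀ t ∈ Set.Ico a b, LinearMap.ker (F t).toLinearMap ≠ ⊥ → t ∈ P) ∧
      ∑ t ∈ P, Cardinal.toENat (Module.rank ℂ (LinearMap.ker (F t).toLinearMap)) +
        operatorNegIndex (F a) = operatorNegIndex (F b) := by
  obtain ⟨P, h1, h2, h3⟩ :=
    exists_finset_sum_jumps hab hF.jump_le hF.eventually_le hF.eventually_ge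
  refine ⟨P, h1, fun t ht hk => h2 t ht fun h0 => hk ?_, ?_⟩
  · have := hF.finiteDimensional_ker (Set.Ico_subset_Icc_self ht)
    exact Submodule.finrank_eq_zero.1 h0
  · rw [← hF.coe_toNat_operatorNegIndex (Set.left_mem_Icc.2 hab),
      ← hF.coe_toNat_operatorNegIndex (Set.right_mem_Icc.2 hab), ← h3, Nat.cast_add, Nat.cast_sum]
    congr 1
    refine Finset.sum_congr rfl fun t ht => ?_
    have := hF.finiteDimensional_ker (Set.Ico_subset_Icc_self (h1 ht))
    rw [← Module.finrank_eq_rank, Cardinal.toENat_nat]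

end IsDecreasingFamily

end Families

/-! ## The Riesz isomorphism and compact perturbations -/

section Riesz

variable {E : Type*} [NormedAddCommGroup E] [InnerProductSpace ℂ E] [CompleteSpace E]

theorem innerSLFlip_bijective : Function.Bijective (innerSLFlip ℂ : E →L[ℂ] ConjSpace E) := by
  constructor
  · refine (injective_iff_map_eq_zero _).2 fun x hx => ?_
    have h : ⟪x, x⟫_ℂ = 0 := congrArg (fun f : ConjSpace E => f x) hx
    exact inner_self_eq_zero.1 h
  · intro f
    let g : StrongDual ℂ E :=
      { toFun := fun x => starRingEnd ℂ (f x)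
        map_add' := fun x y => by simp
        map_smul' := fun a x => by simp
        cont := Complex.continuous_conj.comp f.continuous }
    refine ⟨(InnerProductSpace.toDual ℂ E).symm g, ?_⟩
    ext x
    change ⟪x, _⟫_ℂ = f x
    rw [← inner_conj_symm, InnerProductSpace.toDual_symm_apply]
    exact Complex.conj_conj _

variable (E) in
/-- The Riesz isomorphism of a Hilbert space onto its conjugate space. -/
def rieszEquiv : E ≃L[ℂ] ConjSpace E :=
  ContinuousLinearEquiv.ofBijective (innerSLFlip ℂ)
    (LinearMap.ker_eq_bot.2 innerSLFlip_bijective.1)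
    (LinearMap.range_eq_top.2 innerSLFlip_bijective.2)

@[simp]
theorem rieszEquiv_apply (x y : E) : rieszEquiv E x y = ⟪y, x⟫_ℂ := rfl

theorem coe_rieszEquiv : (rieszEquiv E : E →L[ℂ] ConjSpace E) = innerSLFlip ℂ := rfl

/-- Cover the image of the unit ball under `K` by finitely many balls of radius `ε / 2`. For `x`
orthogonal to the Riesz representatives of the centres, `|K x x| ≤ ε / 2 * ‖x‖²`, so half of the
uniform positivity survives. -/
theorem isEssentiallyPositive_of_isCompactPerturbationOf {F : E →L[ℂ] E}
    (h : IsCompactPerturbationOf IsUniformlyPositive (innerSLFlip ℂ ∘L F)) :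
    IsEssentiallyPositive F := by
  obtain ⟨A, K, ⟨ε, hε, hA⟩, hK, hF⟩ := h
  have htb : TotallyBounded (K '' Metric.closedBall 0 1) :=
    (hK.isCompact_closure_image_closedBall 1).totallyBounded.subset subset_closure
  obtain ⟨t, ht, hcover⟩ := Metric.totallyBounded_iff.1 htb (ε / 2) (half_pos hε)
  have := ht.to_subtype
  refine ⟨ε / 2, half_pos hε, Submodule.span ℂ ((rieszEquiv E).symm '' t),
    FiniteDimensional.span_of_finite ℂ (ht.image _), fun x hx => ?_⟩
  have hKx : ‖K x x‖ ≤ ε / 2 * ‖x‖ ^ 2 := by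
    rcases eq_or_ne x 0 with rfl | h0
    · simp
    have hn : 0 < ‖x‖ := norm_pos_iff.2 h0
    set u : E := ((‖x‖⁻¹ : ℝ) : ℂ) • x with hu
    have hxu : x = ((‖x‖ : ℝ) : ℂ) • u := by
      rw [hu, smul_smul, ← Complex.ofReal_mul, mul_inv_cancel₀ hn.ne', Complex.ofReal_one, one_smul]
    have hu1 : ‖u‖ = 1 := by
      rw [hu, norm_smul, Complex.norm_real, norm_inv, norm_norm, inv_mul_cancel₀ hn.ne']
    have huball : u ∈ Metric.closedBall (0 : E) 1 := by simp [hu1]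
    obtain ⟨y, hy, hyu⟩ := Set.mem_iUnion₂.1 (hcover ⟨u, huball, rfl⟩)
    have hyx : y x = 0 := by
      have h1 : ⟪(rieszEquiv E).symm y, x⟫_ℂ = 0 :=
        hx _ (Submodule.subset_span ⟨y, hy, rfl⟩)
      have h2 : y x = ⟪x, (rieszEquiv E).symm y⟫_ℂ := by
        rw [← rieszEquiv_apply, ContinuousLinearEquiv.apply_symm_apply]
      rw [h2, ← inner_conj_symm, h1, map_zero]
    have hK : K x = ((‖x‖ : ℝ) : ℂ) • K u := by rw [← map_smul, ← hxu]
    have h3 : K x x = ‖x‖ * (K u - y) x := by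
      rw [sub_apply, hyx, sub_zero, hK]
      rfl
    rw [h3, norm_mul, Complex.norm_real, norm_norm]
    rw [Metric.mem_ball, dist_eq_norm] at hyu
    have h4 := (K u - y).le_of_opNorm_le hyu.le x
    nlinarith
  have h1 : ⟪x, F x⟫_ℂ = A x x + K x x := by
    have := congrArg (fun B : E →L[ℂ] ConjSpace E => B x x) hF
    exact this
  have h2 := (hA x).2
  have h3 := (Complex.abs_re_le_norm (K x x)).trans hKx
  have h4 := (abs_le.1 h3).1
  rw [h1, Complex.add_re]
  linarith

end Riesz

/-! ## Resolvents and kernels of operators in a rigging -/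

section RingInverse

variable {E : Type*} [NormedAddCommGroup E] [NormedSpace ℂ E] {C : E →L[ℂ] E}

theorem apply_ringInverse_apply (hu : IsUnit C) (x : E) : C (Ring.inverse C x) = x :=
  congrArg (fun B : E →L[ℂ] E => B x) (Ring.mul_inverse_cancel C hu)

theorem ringInverse_apply_apply (hu : IsUnit C) (x : E) : Ring.inverse C (C x) = x :=
  congrArg (fun B : E →L[ℂ] E => B x) (Ring.inverse_mul_cancel C hu)

end RingInverse

section BulletResolvent

open ContinuousLinearMap (adjoint)

variable {D H : Type*} [NormedAddCommGroup D] [InnerProductSpace ℂ D] [CompleteSpace D]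
  [NormedAddCommGroup H] [InnerProductSpace ℂ H] [CompleteSpace H]
  {I : D →L[ℂ] H} {A : D →L[ℂ] ConjSpace D} {z : ℂ} {C : D →L[ℂ] D}

theorem conjOp_eq (h : H) : conjOp I h = innerSLFlip ℂ (adjoint I h) := by
  ext w
  change ⟪I w, h⟫_ℂ = ⟪w, adjoint I h⟫_ℂ
  rw [ContinuousLinearMap.adjoint_inner_right]

/-- The right-hand side says that `(I y, h + z • I y)` lies in the graph of the induced operator.
Thus solving `(A^• - z) x = h` in `H` is the same as solving an equation with `C` in `D`. -/
theorem apply_eq_adjoint_iff (hC : innerSLFlip ℂ ∘L C = A - z • (conjOp I ∘L I)) (y : D) (h : H) :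
    C y = adjoint I h ↔ A y = conjOp I (h + z • I y) := by
  rw [← innerSLFlip_bijective.1.eq_iff, ← conjOp_eq]
  have h1 : innerSLFlip ℂ (C y) = A y - z • conjOp I (I y) :=
    congrArg (fun B : D →L[ℂ] ConjSpace D => B y) hC
  rw [h1, map_add, map_smul, sub_eq_iff_eq_add]

theorem exists_of_mem_domain (hI : Function.Injective I) (hd : DenseRange I)
    (hC : innerSLFlip ℂ ∘L C = A - z • (conjOp I ∘L I)) (x : (bullet I (conjOp I) A).domain) :
    ∃ y, I y = x ∧ C y = adjoint I (bullet I (conjOp I) A x - z • (x : H)) := by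
  have hmem := (bullet I (conjOp I) A).mem_graph x
  rw [bullet_graph hI (conjOp_injective hd)] at hmem
  obtain ⟨y, hy, hy'⟩ := hmem
  refine ⟨y, hy, ?_⟩
  rw [apply_eq_adjoint_iff hC, hy', hy]
  simp

theorem exists_mem_domain (hI : Function.Injective I) (hd : DenseRange I)
    (hC : innerSLFlip ℂ ∘L C = A - z • (conjOp I ∘L I)) {y : D} {h : H} (hy : C y = adjoint I h) :
    ∃ x : (bullet I (conjOp I) A).domain,
      (x : H) = I y ∧ bullet I (conjOp I) A x - z • (x : H) = h := by
  have hmem : (I y, h + z • I y) ∈ (bullet I (conjOp I) A).graph := by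
    rw [bullet_graph hI (conjOp_injective hd)]
    exact ⟨y, rfl, (apply_eq_adjoint_iff hC y h).1 hy⟩
  obtain ⟨x, hx, hx'⟩ := (LinearPMap.mem_graph_iff _).1 hmem
  refine ⟨x, hx, ?_⟩
  rw [hx', hx, add_sub_cancel_right]

theorem isResolventAt_of_isUnit (hI : Function.Injective I) (hd : DenseRange I)
    (hC : innerSLFlip ℂ ∘L C = A - z • (conjOp I ∘L I)) (hu : IsUnit C) :
    IsResolventAt (bullet I (conjOp I) A) z (I ∘L Ring.inverse C ∘L adjoint I) := by
  constructor
  · intro h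
    exact exists_mem_domain hI hd hC (apply_ringInverse_apply hu _)
  · intro x
    obtain ⟨y, hy, hy'⟩ := exists_of_mem_domain hI hd hC x
    change I (Ring.inverse C (adjoint I _)) = _
    rw [← hy', ringInverse_apply_apply hu, hy]

/-- The kernel of `C`, when `C` represents `A - z I^* I`, is isomorphic to the eigenspace of the
operator induced by `A`. -/
theorem nonempty_ker_equiv_opKer (hI : Function.Injective I) (hd : DenseRange I)
    (hC : innerSLFlip ℂ ∘L C = A - z • (conjOp I ∘L I)) :
    Nonempty (LinearMap.ker C.toLinearMap ≃ₗ[ℂ] opKer (bullet I (conjOp I) A) z) := by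
  set T := bullet I (conjOp I) A with hT
  have hmem : ∀ x : T.domain, x ∈ opKer T z ↔ T x - z • (x : H) = 0 := fun _ => Iff.rfl
  have hex : ∀ y : LinearMap.ker C.toLinearMap, ∃ x : T.domain, (x : H) = I y ∧
      T x - z • (x : H) = 0 := fun y => by
    refine exists_mem_domain hI hd hC ?_
    rw [map_zero]
    exact y.2
  choose f hf hf' using hex
  have hinj : ∀ x x' : opKer T z, ((x : T.domain) : H) = (x' : T.domain) → x = x' :=
    fun _ _ h => Subtype.ext (Subtype.ext h)
  let φ : LinearMap.ker C.toLinearMap →ₗ[ℂ] opKer T z :=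
    { toFun := fun y => ⟨f y, (hmem _).2 (hf' y)⟩
      map_add' := fun y y' => hinj _ _ (by simp [hf])
      map_smul' := fun a y => hinj _ _ (by simp [hf]) }
  have hφ : ∀ y, ((φ y : T.domain) : H) = I y := hf
  refine ⟨LinearEquiv.ofBijective φ ⟨fun y y' h => ?_, fun x => ?_⟩⟩
  · refine Subtype.ext (hI ?_)
    rw [← hφ, ← hφ, h]
  · obtain ⟨y, hy, hy'⟩ := exists_of_mem_domain hI hd hC x
    rw [(hmem x).1 x.2, map_zero] at hy'
    exact ⟨⟨y, hy'⟩, hinj _ _ ((hφ _).trans hy)⟩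

theorem isUnit_of_isSelfAdjoint_of_surjective (hs : IsSelfAdjoint C) (h : Function.Surjective C) :
    IsUnit C := by
  refine ContinuousLinearMap.isUnit_iff_bijective.2 ⟨?_, h⟩
  refine (injective_iff_map_eq_zero _).2 fun x hx => ext_inner_right ℂ fun v => ?_
  obtain ⟨w, rfl⟩ := h v
  rw [hs.inner_map_comm, hx, inner_zero_left, inner_zero_left]

end BulletResolvent

/-! ### Nonreal resolvent points from one self-adjoint resolvent -/

section NonrealPoints

variable {H : Type*} [NormedAddCommGroup H] [InnerProductSpace ℂ H] [CompleteSpace H]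

/-- Rests on the factorization `T - z = (1 - (z - s) R) (T - s)`. -/
theorem mem_opResolventSet_of_isUnit {T : H →ₗ.[ℂ] H} {s z : ℂ} {R : H →L[ℂ] H}
    (hR : IsResolventAt T s R) (hu : IsUnit (1 - (z - s) • R)) : z ∈ opResolventSet T := by
  set U := 1 - (z - s) • R with hU
  have hUx : ∀ x, U x = x - (z - s) • R x := fun x => by simp [hU]
  refine ⟨R * Ring.inverse U, ?_, ?_⟩
  · intro h
    obtain ⟨x, hx, hx'⟩ := hR.1 (Ring.inverse U h)
    refine ⟨x, hx, ?_⟩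
    have h1 : U (Ring.inverse U h) = h := apply_ringInverse_apply hu h
    rw [hUx, ← hx', hR.2 x] at h1
    rw [← h1, sub_smul]
    abel
  · intro x
    have h1 : T x - z • (x : H) = U (T x - s • (x : H)) := by
      rw [hUx, hR.2 x, sub_smul]
      abel
    change R (Ring.inverse U _) = _
    rw [h1, ringInverse_apply_apply hu, hR.2 x]

/-- The spectrum of `R` is real, so it does not contain `(z - s)⁻¹`. This disposes of the nonreal
points near an eigenvalue. -/
theorem mem_opResolventSet_of_im_ne_zero {T : H →ₗ.[ℂ] H} {s : ℝ} {R : H →L[ℂ] H}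
    (hR : IsResolventAt T s R) (hs : IsSelfAdjoint R) {z : ℂ} (hz : z.im ≠ 0) :
    z ∈ opResolventSet T := by
  refine mem_opResolventSet_of_isUnit hR ?_
  have hzs : z - s ≠ 0 := fun h => hz (by simpa using congrArg Complex.im h)
  have h1 : (z - s)⁻¹ ∉ spectrum ℂ R := fun hmem => by
    have h2 := hs.mem_spectrum_eq_re hmem
    have h3 : ((z - s)⁻¹).im = 0 := by rw [h2, Complex.ofReal_im]
    rw [Complex.inv_im, div_eq_zero_iff] at h3
    rcases h3 with h3 | h3
    · exact hz (by simpa using h3)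
    · exact hzs (Complex.normSq_eq_zero.1 h3)
  rw [spectrum.mem_iff, not_not] at h1
  have h2 : (1 : H →L[ℂ] H) - (z - s) • R =
      (Units.mk0 _ hzs) • (algebraMap ℂ (H →L[ℂ] H) (z - s)⁻¹ - R) := by
    rw [Units.smul_def, Units.val_mk0, smul_sub, Algebra.algebraMap_eq_smul_one, smul_smul,
      mul_inv_cancel₀ hzs, one_smul]
  rw [h2]
  exact h1.smul _

end NonrealPoints

/-! ### Multiplicities -/

section Multiplicity

theorem toENat_rank_congr {V W : Type*} [AddCommGroup V] [Module ℂ V] [AddCommGroup W] [Module ℂ W]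
    (e : V ≃ₗ[ℂ] W) :
    Cardinal.toENat (Module.rank ℂ V) = Cardinal.toENat (Module.rank ℂ W) := by
  have h := congrArg Cardinal.toENat e.lift_rank_eq
  rwa [Cardinal.toENat_lift, Cardinal.toENat_lift] at h

variable {B : Type*} [NormedAddCommGroup B] [NormedSpace ℂ B]

theorem totalMultiplicity_eq_sum {T : B →ₗ.[ℂ] B} {J : Set ℝ} {P : Finset ℝ}
    (hP : (P : Set ℝ) ⊆ J) (h : ∀ l ∈ J, opKer T l ≠ ⊥ → l ∈ P) :
    totalMultiplicity T J = ∑ l ∈ P, Cardinal.toENat (Module.rank ℂ (opKer T l)) := by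
  refine le_antisymm (iSup₂_le fun F hF => ?_) (le_iSup₂_of_le P hP le_rfl)
  refine Finset.sum_le_sum_of_ne_zero fun l hl h0 => h l (hF hl) fun hbot => h0 ?_
  rw [hbot, rank_bot, map_zero]

end Multiplicity

namespace BlockMatrix

open ContinuousLinearMap (adjoint)

variable {H₁ H₂ : Type*} [NormedAddCommGroup H₁] [InnerProductSpace ℂ H₁] [CompleteSpace H₁]
  [NormedAddCommGroup H₂] [InnerProductSpace ℂ H₂] [CompleteSpace H₂] (M : BlockMatrix H₁ H₂)

/-! ## The Schur complement as a family of operators in a Hilbert space -/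

/-- The operator in `D₂` that represents `T₂₂ - z I₂^* I₂`. -/
def pencil₂ (z : ℂ) : M.D₂ →L[ℂ] M.D₂ := (M.τ - z) • (adjoint M.I₂ ∘L M.I₂) - 1

/-- The operator in `D₁` that represents `T₁₁ - z I₁^* I₁`. -/
def pencil₁ (z : ℂ) : M.D₁ →L[ℂ] M.D₁ :=
  1 + (M.ϰ - z) • (adjoint M.I₁ ∘L M.I₁) - adjoint M.G ∘L M.G

/-- The operator in `D₁` that represents the Schur complement. -/
def schur (z : ℂ) : M.D₁ →L[ℂ] M.D₁ :=
  M.pencil₁ z - adjoint M.G ∘L Ring.inverse (M.pencil₂ z) ∘L M.G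

theorem inner_pencil₁ (z : ℂ) (x y : M.D₁) : ⟪x, M.pencil₁ z y⟫_ℂ =
    ⟪x, y⟫_ℂ + (M.ϰ - z) * ⟪M.I₁ x, M.I₁ y⟫_ℂ - ⟪M.G x, M.G y⟫_ℂ := by
  change ⟪x, y + (M.ϰ - z) • adjoint M.I₁ (M.I₁ y) - adjoint M.G (M.G y)⟫_ℂ = _
  rw [inner_sub_right, inner_add_right, inner_smul_right, ContinuousLinearMap.adjoint_inner_right,
    ContinuousLinearMap.adjoint_inner_right]

theorem inner_pencil₂ (z : ℂ) (x y : M.D₂) : ⟪x, M.pencil₂ z y⟫_ℂ =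
    (M.τ - z) * ⟪M.I₂ x, M.I₂ y⟫_ℂ - ⟪x, y⟫_ℂ := by
  change ⟪x, (M.τ - z) • adjoint M.I₂ (M.I₂ y) - y⟫_ℂ = _
  rw [inner_sub_right, inner_smul_right, ContinuousLinearMap.adjoint_inner_right]

theorem inner_schur (z : ℂ) (x y : M.D₁) : ⟪x, M.schur z y⟫_ℂ =
    ⟪x, M.pencil₁ z y⟫_ℂ - ⟪M.G x, Ring.inverse (M.pencil₂ z) (M.G y)⟫_ℂ := by
  change ⟪x, M.pencil₁ z y - adjoint M.G (Ring.inverse (M.pencil₂ z) (M.G y))⟫_ℂ = _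
  rw [inner_sub_right, ContinuousLinearMap.adjoint_inner_right]

theorem isSelfAdjoint_pencil₁ (l : ℝ) : IsSelfAdjoint (M.pencil₁ l) := by
  refine ContinuousLinearMap.isSelfAdjoint_iff_isSymmetric.2 fun x y => ?_
  change ⟪M.pencil₁ l x, y⟫_ℂ = ⟪x, M.pencil₁ l y⟫_ℂ
  rw [← inner_conj_symm, inner_pencil₁, inner_pencil₁]
  simp only [map_sub, map_add, map_mul, inner_conj_symm, Complex.conj_ofReal]

theorem isSelfAdjoint_pencil₂ (l : ℝ) : IsSelfAdjoint (M.pencil₂ l) := by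
  refine ContinuousLinearMap.isSelfAdjoint_iff_isSymmetric.2 fun x y => ?_
  change ⟪M.pencil₂ l x, y⟫_ℂ = ⟪x, M.pencil₂ l y⟫_ℂ
  rw [← inner_conj_symm, inner_pencil₂, inner_pencil₂]
  simp only [map_sub, map_mul, inner_conj_symm, Complex.conj_ofReal]

theorem isSelfAdjoint_schur (l : ℝ) : IsSelfAdjoint (M.schur l) := by
  have h := (M.isSelfAdjoint_pencil₂ l).ringInverse
  refine ContinuousLinearMap.isSelfAdjoint_iff_isSymmetric.2 fun x y => ?_
  change ⟪M.schur l x, y⟫_ℂ = ⟪x, M.schur l y⟫_ℂ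
  rw [← inner_conj_symm, inner_schur, inner_schur, map_sub, inner_conj_symm, inner_conj_symm,
    ← (M.isSelfAdjoint_pencil₁ l).inner_map_comm, ← h.inner_map_comm]

theorem innerSLFlip_comp_pencil₂ (z : ℂ) :
    innerSLFlip ℂ ∘L M.pencil₂ z = M.A₂₂ - z • (conjOp M.I₂ ∘L M.I₂) := by
  ext y w
  change ⟪w, M.pencil₂ z y⟫_ℂ = M.A₂₂ y w - z * ⟪M.I₂ w, M.I₂ y⟫_ℂ
  rw [inner_pencil₂, A₂₂_apply]
  ring

theorem A₁₁_apply (y w : M.D₁) : M.A₁₁ y w =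
    ⟪w, y⟫_ℂ + M.ϰ * ⟪M.I₁ w, M.I₁ y⟫_ℂ - ⟪M.G w, M.G y⟫_ℂ := by
  rw [A₁₁_eq]
  rfl

theorem A₁₂_apply (y : M.D₂) (w : M.D₁) : M.A₁₂ y w = ⟪M.G w, y⟫_ℂ := by
  rw [A₁₂_eq]
  rfl

theorem A₂₁_apply (y : M.D₁) (w : M.D₂) : M.A₂₁ y w = ⟪w, M.G y⟫_ℂ := by
  rw [A₂₁_eq]
  rfl

theorem S_eq (l : ℝ) : M.S l = innerSLFlip ℂ ∘L M.schur l := by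
  -- Both inverses default to zero when `pencil₂ l` is not invertible, so no condition on `l` is
  -- needed.
  have h1 : (M.A₂₂ - (l : ℂ) • (conjOp M.I₂ ∘L M.I₂)).inverse =
      Ring.inverse (M.pencil₂ l) ∘L ((rieszEquiv M.D₂).symm : ConjSpace M.D₂ →L[ℂ] M.D₂) := by
    rw [← innerSLFlip_comp_pencil₂, ← coe_rieszEquiv, ContinuousLinearMap.inverse_equiv_comp,
      ContinuousLinearMap.ringInverse_eq_inverse]
  ext y w
  rw [S, h1, A₂₁_eq, ← coe_rieszEquiv]
  change M.A₁₁ y w - l * ⟪M.I₁ w, M.I₁ y⟫_ℂ - M.A₁₂ (Ring.inverse (M.pencil₂ l)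
    ((rieszEquiv M.D₂).symm (rieszEquiv M.D₂ (M.G y)))) w = ⟪w, M.schur l y⟫_ℂ
  rw [ContinuousLinearEquiv.symm_apply_apply, A₁₁_apply, A₁₂_apply, inner_schur, inner_pencil₁]
  ring

theorem negIndex_S (l : ℝ) : negIndex (M.S l) = operatorNegIndex (M.schur l) := by
  rw [S_eq, operatorNegIndex]

theorem negIndex_neg_S (l : ℝ) : negIndex (-M.S l) = operatorNegIndex (-M.schur l) := by
  rw [S_eq, operatorNegIndex, ContinuousLinearMap.comp_neg]

/-- The resolvent in `H₂` solves `pencil₂ l y = f` only for `f` in the range of the adjoint of `I₂`.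
This suffices because `pencil₂ l` differs from `-1` by a multiple of `I₂† I₂`. -/
theorem isUnit_pencil₂ {l : ℝ} (hl : (l : ℂ) ∈ opResolventSet M.bullet₂₂) :
    IsUnit (M.pencil₂ l) := by
  obtain ⟨R, hR⟩ := hl
  refine isUnit_of_isSelfAdjoint_of_surjective (M.isSelfAdjoint_pencil₂ l) fun v => ?_
  obtain ⟨x, hx, hx'⟩ := hR.1 (M.I₂ v)
  obtain ⟨y, hy, hy'⟩ := exists_of_mem_domain M.I₂_injective M.denseRange_I₂
    (M.innerSLFlip_comp_pencil₂ l) x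
  have hy'' : M.pencil₂ l y = adjoint M.I₂ (M.I₂ v) := hy'.trans (congrArg _ hx')
  -- With `pencil₂ l y = I₂† I₂ v`, the terms `(τ - l) I₂† I₂ v` cancel and `v` remains.
  refine ⟨((M.τ : ℂ) - l) • y - v, ?_⟩
  rw [map_sub, map_smul, hy'']
  change _ - ((M.τ - (l : ℂ)) • adjoint M.I₂ (M.I₂ v) - v) = v
  abel

/-! ## The pencil of the angular extension -/

/-- The operator in `D` that represents `T - z I^* I`. -/
def pencil (z : ℂ) : M.D →L[ℂ] M.D :=
  ((rieszEquiv M.D).symm : ConjSpace M.D →L[ℂ] M.D) ∘L (M.A - z • (conjOp M.I ∘L M.I))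

theorem innerSLFlip_comp_pencil (z : ℂ) :
    innerSLFlip ℂ ∘L M.pencil z = M.A - z • (conjOp M.I ∘L M.I) := by
  ext y w
  exact congrArg (fun f : ConjSpace M.D => f w) ((rieszEquiv M.D).apply_symm_apply _)

theorem pencil_apply (z : ℂ) (y : M.D) : M.pencil z y =
    WithLp.toLp 2 (M.pencil₁ z y.fst + adjoint M.G y.snd, M.G y.fst + M.pencil₂ z y.snd) := by
  refine ext_inner_left ℂ fun w => ?_
  have h1 : ⟪w, M.pencil z y⟫_ℂ = M.A y w - z * ⟪M.I w, M.I y⟫_ℂ :=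
    congrArg (fun B : M.D →L[ℂ] ConjSpace M.D => B y w) (M.innerSLFlip_comp_pencil z)
  rw [h1, A_apply, I_apply, I_apply, WithLp.prod_inner_apply, WithLp.prod_inner_apply]
  change _ - z * (⟪M.I₁ w.fst, M.I₁ y.fst⟫_ℂ + ⟪M.I₂ w.snd, M.I₂ y.snd⟫_ℂ) =
    ⟪w.fst, M.pencil₁ z y.fst + adjoint M.G y.snd⟫_ℂ +
      ⟪w.snd, M.G y.fst + M.pencil₂ z y.snd⟫_ℂ
  rw [inner_add_right, inner_add_right, inner_pencil₁, inner_pencil₂, A₁₁_apply, A₁₂_apply,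
    A₂₁_apply, A₂₂_apply, ContinuousLinearMap.adjoint_inner_right]
  ring

theorem inner_pencil (z : ℂ) (w y : M.D) : ⟪w, M.pencil z y⟫_ℂ =
    ⟪w.fst, M.pencil₁ z y.fst⟫_ℂ + ⟪M.G w.fst, y.snd⟫_ℂ +
      (⟪w.snd, M.G y.fst⟫_ℂ + ⟪w.snd, M.pencil₂ z y.snd⟫_ℂ) := by
  rw [pencil_apply, WithLp.prod_inner_apply]
  change ⟪w.fst, M.pencil₁ z y.fst + adjoint M.G y.snd⟫_ℂ +
      ⟪w.snd, M.G y.fst + M.pencil₂ z y.snd⟫_ℂ = _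
  rw [inner_add_right, inner_add_right, ContinuousLinearMap.adjoint_inner_right]

theorem isSelfAdjoint_pencil (l : ℝ) : IsSelfAdjoint (M.pencil l) := by
  refine ContinuousLinearMap.isSelfAdjoint_iff_isSymmetric.2 fun x y => ?_
  change ⟪M.pencil l x, y⟫_ℂ = ⟪x, M.pencil l y⟫_ℂ
  rw [← inner_conj_symm, inner_pencil, inner_pencil]
  simp only [map_add, inner_conj_symm]
  rw [← (M.isSelfAdjoint_pencil₁ l).inner_map_comm, ← (M.isSelfAdjoint_pencil₂ l).inner_map_comm]
  ring

/-- Block Gaussian elimination: solve the second row for `y.snd` and insert the result into the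
first. -/
theorem pencil_apply_eq_iff {z : ℂ} (hu : IsUnit (M.pencil₂ z)) (y f : M.D) :
    M.pencil z y = f ↔
      M.schur z y.fst = f.fst - adjoint M.G (Ring.inverse (M.pencil₂ z) f.snd) ∧
        y.snd = Ring.inverse (M.pencil₂ z) (f.snd - M.G y.fst) := by
  have hS : M.schur z y.fst = M.pencil₁ z y.fst -
    adjoint M.G (Ring.inverse (M.pencil₂ z) (M.G y.fst)) := rfl
  have h2 : y.snd = Ring.inverse (M.pencil₂ z) (f.snd - M.G y.fst) ↔
      M.G y.fst + M.pencil₂ z y.snd = f.snd := by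
    constructor
    · intro h
      rw [h, apply_ringInverse_apply hu]
      abel
    · intro h
      rw [← h, add_sub_cancel_left, ringInverse_apply_apply hu]
  have h1 : M.pencil z y = f ↔
      M.pencil₁ z y.fst + adjoint M.G y.snd = f.fst ∧ M.G y.fst + M.pencil₂ z y.snd = f.snd := by
    rw [pencil_apply]
    constructor
    · rintro rfl
      exact ⟨rfl, rfl⟩
    · rintro ⟨h, h'⟩
      rw [h, h']
      rfl
  rw [h1, ← h2]
  refine and_congr_left fun h => ?_
  rw [hS, h, map_sub, map_sub]
  constructor
  · rintro h'
    rw [← h']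
    abel
  · intro h'
    rw [sub_eq_iff_eq_add] at h'
    rw [h']
    abel

theorem nonempty_ker_schur_equiv {z : ℂ} (hu : IsUnit (M.pencil₂ z)) :
    Nonempty (LinearMap.ker (M.schur z).toLinearMap ≃ₗ[ℂ]
      LinearMap.ker (M.pencil z).toLinearMap) := by
  have hmem : ∀ y : M.D, y ∈ LinearMap.ker (M.pencil z).toLinearMap ↔
      M.schur z y.fst = 0 ∧ y.snd = -Ring.inverse (M.pencil₂ z) (M.G y.fst) := fun y => by
    have h := M.pencil_apply_eq_iff hu y 0
    simpa using h
  let φ : LinearMap.ker (M.pencil z).toLinearMap →ₗ[ℂ] LinearMap.ker (M.schur z).toLinearMap :=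
    { toFun := fun y => ⟨(y : M.D).fst, ((hmem y).1 y.2).1⟩
      map_add' := fun _ _ => rfl
      map_smul' := fun _ _ => rfl }
  refine ⟨(LinearEquiv.ofBijective φ ⟨fun y y' h => ?_, fun x => ?_⟩).symm⟩
  · have h1 : (y : M.D).fst = (y' : M.D).fst := congrArg Subtype.val h
    have h2 : (y : M.D).snd = (y' : M.D).snd := by
      rw [((hmem y).1 y.2).2, ((hmem y').1 y'.2).2, h1]
    exact Subtype.ext (WithLp.ofLp_injective 2 (Prod.ext h1 h2))
  · exact ⟨⟨WithLp.toLp 2 (x, -Ring.inverse (M.pencil₂ z) (M.G x)), (hmem _).2 ⟨x.2, rfl⟩⟩, rfl⟩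

theorem isUnit_pencil {l : ℝ} (hu : IsUnit (M.pencil₂ l)) (hs : IsUnit (M.schur l)) :
    IsUnit (M.pencil l) := by
  refine isUnit_of_isSelfAdjoint_of_surjective (M.isSelfAdjoint_pencil l) fun f => ?_
  set x := Ring.inverse (M.schur l) (f.fst - adjoint M.G (Ring.inverse (M.pencil₂ l) f.snd))
  exact ⟨WithLp.toLp 2 (x, Ring.inverse (M.pencil₂ l) (f.snd - M.G x)),
    (M.pencil_apply_eq_iff hu _ f).2 ⟨apply_ringInverse_apply hs _, rfl⟩⟩

theorem exists_isResolventAt {l : ℝ} (hu : IsUnit (M.pencil₂ l)) (hs : IsUnit (M.schur l)) :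
    ∃ R, IsResolventAt M.angularExtension l R ∧ IsSelfAdjoint R := by
  refine ⟨_, isResolventAt_of_isUnit M.I_injective M.denseRange_I (M.innerSLFlip_comp_pencil l)
    (M.isUnit_pencil hu hs), ?_⟩
  exact (M.isSelfAdjoint_pencil l).ringInverse.conj_adjoint M.I

theorem nonempty_ker_schur_equiv_opKer {l : ℝ} (hu : IsUnit (M.pencil₂ l)) :
    Nonempty (LinearMap.ker (M.schur l).toLinearMap ≃ₗ[ℂ] opKer M.angularExtension l) := by
  obtain ⟨e⟩ := M.nonempty_ker_schur_equiv hu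
  obtain ⟨e'⟩ := nonempty_ker_equiv_opKer M.I_injective M.denseRange_I
    (M.innerSLFlip_comp_pencil l)
  exact ⟨e.trans e'⟩

end BlockMatrix

namespace BlockMatrix

open ContinuousLinearMap (adjoint)
open Filter Topology

variable {H₁ H₂ : Type*} [NormedAddCommGroup H₁] [InnerProductSpace ℂ H₁] [CompleteSpace H₁]
  [NormedAddCommGroup H₂] [InnerProductSpace ℂ H₂] [CompleteSpace H₂] (M : BlockMatrix H₁ H₂)

/-! ## Continuity and monotonicity of the Schur complement -/

theorem hasDerivAt_pencil₂ (z : ℂ) :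
    HasDerivAt M.pencil₂ (-(adjoint M.I₂ ∘L M.I₂)) z := by
  have h := (((hasDerivAt_id z).const_sub (M.τ : ℂ)).smul_const (adjoint M.I₂ ∘L M.I₂)).sub_const 1
  rw [neg_one_smul] at h
  exact h

theorem hasDerivAt_ringInverse_pencil₂ {z : ℂ} (hu : IsUnit (M.pencil₂ z)) :
    HasDerivAt (fun w => Ring.inverse (M.pencil₂ w)) (Ring.inverse (M.pencil₂ z) ∘L
      (adjoint M.I₂ ∘L M.I₂) ∘L Ring.inverse (M.pencil₂ z)) z := by
  have h1 := hasFDerivAt_ringInverse (𝕜 := ℂ) hu.unit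
  rw [IsUnit.unit_spec] at h1
  have h2 := h1.comp_hasDerivAt z (M.hasDerivAt_pencil₂ z)
  have h3 : Ring.inverse (M.pencil₂ z) = ↑hu.unit⁻¹ := Ring.inverse_of_isUnit hu
  rw [h3]
  refine h2.congr_deriv ?_
  simp only [neg_apply, map_neg, neg_neg, ContinuousLinearMap.mulLeftRight_apply]
  rfl

/-- Since the derivative of `pencil₂` is `-I₂† I₂`, that of its inverse is `pencil₂⁻¹ I₂† I₂
pencil₂⁻¹`; self-adjointness at real `l` turns the form of the latter into a squared norm. The
derivative is taken in the complex variable and then restricted to the real axis. -/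
theorem hasDerivAt_inner_schur {l : ℝ} (hu : IsUnit (M.pencil₂ l)) (x : M.D₁) :
    HasDerivAt (fun t : ℝ => (⟪x, M.schur t x⟫_ℂ).re)
      (-(‖M.I₁ x‖ ^ 2 + ‖M.I₂ (Ring.inverse (M.pencil₂ l) (M.G x))‖ ^ 2)) l := by
  set u := Ring.inverse (M.pencil₂ l) (M.G x) with hudef
  have h1 : HasDerivAt (fun z : ℂ => ⟪x, M.pencil₁ z x⟫_ℂ) (-⟪M.I₁ x, M.I₁ x⟫_ℂ) l := by
    have h := ((((hasDerivAt_id (l : ℂ)).const_sub (M.ϰ : ℂ)).mul_const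
      ⟪M.I₁ x, M.I₁ x⟫_ℂ).const_add ⟪x, x⟫_ℂ).sub_const ⟪M.G x, M.G x⟫_ℂ
    rw [neg_one_mul] at h
    refine h.congr_of_eventuallyEq (Eventually.of_forall fun z => ?_)
    exact M.inner_pencil₁ z x x
  have h2 : HasDerivAt (fun z : ℂ => ⟪M.G x, Ring.inverse (M.pencil₂ z) (M.G x)⟫_ℂ)
      ⟪M.I₂ u, M.I₂ u⟫_ℂ l := by
    have h := (innerSL ℂ (M.G x) ∘L
      ContinuousLinearMap.apply ℂ M.D₂ (M.G x)).hasFDerivAt.comp_hasDerivAt (l : ℂ) (M.hasDerivAt_ringInverse_pencil₂ hu)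
    refine h.congr_deriv ?_
    change ⟪M.G x, Ring.inverse (M.pencil₂ l) (adjoint M.I₂ (M.I₂ u))⟫_ℂ = _
    rw [(M.isSelfAdjoint_pencil₂ l).ringInverse.inner_map_comm,
      ContinuousLinearMap.adjoint_inner_right]
  have h3 : HasDerivAt (fun z : ℂ => ⟪x, M.schur z x⟫_ℂ)
      (-⟪M.I₁ x, M.I₁ x⟫_ℂ - ⟪M.I₂ u, M.I₂ u⟫_ℂ) l := by
    refine (h1.sub h2).congr_of_eventuallyEq (Eventually.of_forall fun z => ?_)
    exact M.inner_schur z x x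
  refine h3.real_of_complex.congr_deriv ?_
  rw [inner_self_eq_norm_sq_to_K, inner_self_eq_norm_sq_to_K, Complex.sub_re, Complex.neg_re]
  have h4 : ∀ r : ℝ, (((r : ℂ)) ^ 2).re = r ^ 2 := fun r => by
    rw [← Complex.ofReal_pow, Complex.ofReal_re]
  change -(((‖M.I₁ x‖ : ℝ) : ℂ) ^ 2).re - (((‖M.I₂ u‖ : ℝ) : ℂ) ^ 2).re = _
  rw [h4, h4]
  ring

theorem continuousAt_schur {l : ℝ} (hu : IsUnit (M.pencil₂ l)) :
    ContinuousAt (fun t : ℝ => M.schur t) l := by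
  have h1 : ContinuousAt (fun z : ℂ => Ring.inverse (M.pencil₂ z)) l :=
    (M.hasDerivAt_ringInverse_pencil₂ hu).continuousAt
  have h2 : ContinuousAt M.schur (l : ℂ) := by
    refine ContinuousAt.sub ?_ ?_
    · unfold pencil₁
      fun_prop
    · exact ContinuousAt.clm_comp continuousAt_const (h1.clm_comp continuousAt_const)
  exact ContinuousAt.comp (f := fun t : ℝ => (t : ℂ)) h2 Complex.continuous_ofReal.continuousAt

theorem strictAntiOn_inner_schur {a b : ℝ} (hu : ∀ l ∈ Set.Icc a b, IsUnit (M.pencil₂ l))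
    {x : M.D₁} (hx : x ≠ 0) :
    StrictAntiOn (fun t : ℝ => (⟪x, M.schur t x⟫_ℂ).re) (Set.Icc a b) := by
  refine strictAntiOn_of_deriv_neg (convex_Icc a b)
    (fun l hl => (M.hasDerivAt_inner_schur (hu l hl) x).continuousAt.continuousWithinAt)
    fun l hl => ?_
  rw [(M.hasDerivAt_inner_schur (hu l (interior_subset hl)) x).deriv]
  have h1 : 0 < ‖M.I₁ x‖ := norm_pos_iff.2 fun h => hx (M.I₁_injective (by rw [h, map_zero]))
  have h2 := pow_pos h1 2
  have h3 := sq_nonneg ‖M.I₂ (Ring.inverse (M.pencil₂ l) (M.G x))‖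
  linarith

theorem isDecreasingFamily_schur {a b : ℝ} (hu : ∀ l ∈ Set.Icc a b, IsUnit (M.pencil₂ l))
    (hb : IsEssentiallyPositive (M.schur b)) :
    IsDecreasingFamily (fun t : ℝ => M.schur t) a b where
  isSelfAdjoint t _ := M.isSelfAdjoint_schur t
  continuousOn t ht := (M.continuousAt_schur (hu t ht)).continuousWithinAt
  decreasing _ hs _ ht hst _ hx := M.strictAntiOn_inner_schur hu hx hs ht hst
  isEssentiallyPositive := hb

/-- Two sign changes, of the operator and of the parameter, preserve the direction of monotonicity
and move the essentially positive endpoint to the right. -/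
theorem isDecreasingFamily_neg_schur {a b : ℝ} (hu : ∀ l ∈ Set.Icc a b, IsUnit (M.pencil₂ l))
    (ha : IsEssentiallyPositive (-M.schur a)) :
    IsDecreasingFamily (fun t : ℝ => -M.schur (-t : ℝ)) (-b) (-a) := by
  have hneg : ∀ t ∈ Set.Icc (-b) (-a), -t ∈ Set.Icc a b := fun t ht =>
    ⟨by linarith [ht.2], by linarith [ht.1]⟩
  refine ⟨fun t _ => (M.isSelfAdjoint_schur (-t)).neg, fun t ht => ?_, ?_, ?_⟩
  · refine ContinuousAt.continuousWithinAt (ContinuousAt.neg ?_)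
    exact ContinuousAt.comp (f := fun t : ℝ => -t) (M.continuousAt_schur (hu (-t) (hneg t ht)))
      continuousAt_neg
  · intro s hs t ht hst x hx
    have := M.strictAntiOn_inner_schur hu hx (hneg t ht) (hneg s hs) (neg_lt_neg hst)
    simp only [neg_apply, inner_neg_right, Complex.neg_re]
    exact neg_lt_neg this
  · simpa using ha

theorem eventually_isUnit_pencil₂ {l : ℝ} (hu : IsUnit (M.pencil₂ l)) :
    ∀ᶠ s : ℝ in 𝓝 l, IsUnit (M.pencil₂ s) := by
  have h1 : ContinuousAt (fun s : ℝ => M.pencil₂ s) l :=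
    ContinuousAt.comp (f := fun t : ℝ => (t : ℂ)) (M.hasDerivAt_pencil₂ l).continuousAt
      Complex.continuous_ofReal.continuousAt
  exact h1.eventually (Units.isOpen.mem_nhds hu)

theorem exists_lt_isUnit_pencil₂ {a b : ℝ} (hab : a ≤ b)
    (hu : ∀ l ∈ Set.Icc a b, IsUnit (M.pencil₂ l)) :
    ∃ a' < a, ∀ l ∈ Set.Icc a' b, IsUnit (M.pencil₂ l) := by
  obtain ⟨r, hr, h⟩ := Metric.eventually_nhds_iff.1
    (M.eventually_isUnit_pencil₂ (hu a ⟨le_rfl, hab⟩))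
  refine ⟨a - r / 2, by linarith, fun l hl => ?_⟩
  rcases le_total a l with hal | hal
  · exact hu l ⟨hal, hl.2⟩
  · refine h ?_
    rw [Real.dist_eq, abs_lt]
    exact ⟨by linarith [hl.1], by linarith⟩

theorem exists_gt_isUnit_pencil₂ {a b : ℝ} (hab : a ≤ b)
    (hu : ∀ l ∈ Set.Icc a b, IsUnit (M.pencil₂ l)) :
    ∃ b' > b, ∀ l ∈ Set.Icc a b', IsUnit (M.pencil₂ l) := by
  obtain ⟨r, hr, h⟩ := Metric.eventually_nhds_iff.1
    (M.eventually_isUnit_pencil₂ (hu b ⟨hab, le_rfl⟩))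
  refine ⟨b + r / 2, by linarith, fun l hl => ?_⟩
  rcases le_total l b with hal | hal
  · exact hu l ⟨hl.1, hal⟩
  · refine h ?_
    rw [Real.dist_eq, abs_lt]
    exact ⟨by linarith, by linarith [hl.2]⟩

/-! ## Discreteness of the spectrum -/

theorem isPurelyDiscreteOn_of_schur {J : Set ℝ}
    (hJ : ∀ l ∈ J, IsUnit (M.pencil₂ l))
    (hfin : ∀ l ∈ J, FiniteDimensional ℂ (LinearMap.ker (M.schur l).toLinearMap))
    (hunit : ∀ l ∈ J, LinearMap.ker (M.schur l).toLinearMap = ⊥ → IsUnit (M.schur l))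
    (hisol : ∀ l ∈ J, ∀ᶠ s : ℝ in 𝓝[≠] l, IsUnit (M.schur s)) :
    IsPurelyDiscreteOn M.angularExtension J := by
  intro l hl hspec
  obtain ⟨e⟩ := M.nonempty_ker_schur_equiv_opKer (hJ l hl)
  have := hfin l hl
  refine ⟨fun hbot => ?_, e.finiteDimensional, ?_⟩
  · have hker : LinearMap.ker (M.schur l).toLinearMap = ⊥ := by
      refine (Submodule.eq_bot_iff _).2 fun x hx => ?_
      have h1 : ((e ⟨x, hx⟩ : opKer M.angularExtension l) : M.angularExtension.domain) = 0 :=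
        (Submodule.eq_bot_iff _).1 hbot _ (e ⟨x, hx⟩).2
      have h2 : e ⟨x, hx⟩ = 0 := Subtype.ext h1
      exact congrArg Subtype.val (e.map_eq_zero_iff.1 h2)
    obtain ⟨R, hR, -⟩ := M.exists_isResolventAt (hJ l hl) (hunit l hl hker)
    exact hspec ⟨R, hR⟩
  · have h1 : ∀ᶠ s : ℝ in 𝓝[≠] l, IsUnit (M.pencil₂ s) ∧ IsUnit (M.schur s) :=
      ((M.eventually_isUnit_pencil₂ (hJ l hl)).filter_mono nhdsWithin_le_nhds).and (hisol l hl)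
    obtain ⟨r, hr, h2⟩ := Metric.eventually_nhds_iff.1 (eventually_nhdsWithin_iff.1 h1)
    have hres : ∀ s : ℝ, s ≠ l → |s - l| < r →
        ∃ R, IsResolventAt M.angularExtension s R ∧ IsSelfAdjoint R := fun s hs hsr => by
      obtain ⟨h3, h4⟩ := h2 (y := s) hsr hs
      exact M.exists_isResolventAt h3 h4
    refine ⟨r, hr, fun z hz hzr => ?_⟩
    by_cases hz0 : z.im = 0
    · have hzre : z = (z.re : ℝ) := Complex.ext rfl (by simpa using hz0)
      rw [hzre, ← Complex.ofReal_sub, Complex.norm_real] at hzr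
      obtain ⟨R, hR, -⟩ := hres z.re (fun h => hz (by rw [hzre, h])) hzr
      rw [hzre]
      exact ⟨R, hR⟩
    -- Any real resolvent point serves as the base point for the nonreal ones; `l + r / 2` is one
    -- inside the punctured neighbourhood.
    · obtain ⟨R, hR, hRs⟩ := hres (l + r / 2) (by linarith)
        (by rw [add_sub_cancel_left, abs_of_pos (half_pos hr)]; linarith)
      exact mem_opResolventSet_of_im_ne_zero hR hRs hz0

theorem toENat_rank_ker_schur {l : ℝ} (hu : IsUnit (M.pencil₂ l)) :
    Cardinal.toENat (Module.rank ℂ (opKer M.angularExtension l)) =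
      Cardinal.toENat (Module.rank ℂ (LinearMap.ker (M.schur l).toLinearMap)) :=
  (toENat_rank_congr (M.nonempty_ker_schur_equiv_opKer hu).some).symm

theorem totalMultiplicity_eq_sum_schur {J : Set ℝ} (hJ : ∀ l ∈ J, IsUnit (M.pencil₂ l))
    {P : Finset ℝ} (hP : (P : Set ℝ) ⊆ J)
    (h : ∀ l ∈ J, LinearMap.ker (M.schur l).toLinearMap ≠ ⊥ → l ∈ P) :
    totalMultiplicity M.angularExtension J =
      ∑ l ∈ P, Cardinal.toENat (Module.rank ℂ (LinearMap.ker (M.schur l).toLinearMap)) := by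
  rw [totalMultiplicity_eq_sum hP fun l hl hne => h l hl fun hbot => hne ?_]
  · exact Finset.sum_congr rfl fun l hl => M.toENat_rank_ker_schur (hJ l (hP hl))
  · have h1 := M.toENat_rank_ker_schur (hJ l hl)
    rw [hbot, rank_bot, map_zero, Cardinal.toENat_eq_zero] at h1
    exact Submodule.rank_eq_zero.1 h1

theorem isPurelyDiscreteOn_of_isEssentiallyPositive {a b : ℝ} (hab : a ≤ b)
    (hu : ∀ l ∈ Set.Icc a b, IsUnit (M.pencil₂ l)) (hb : IsEssentiallyPositive (M.schur b)) :
    IsPurelyDiscreteOn M.angularExtension (Set.Ico a b) := by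
  -- Isolation at `a` needs a two-sided neighbourhood; invertibility of `pencil₂` is an open
  -- condition, so the family extends to the left of `a`.
  obtain ⟨a', ha', hu'⟩ := M.exists_lt_isUnit_pencil₂ hab hu
  have hF := M.isDecreasingFamily_schur hu' hb
  have hmem : ∀ l ∈ Set.Ico a b, l ∈ Set.Ioo a' b := fun l hl => ⟨ha'.trans_le hl.1, hl.2⟩
  refine M.isPurelyDiscreteOn_of_schur (fun l hl => hu l ⟨hl.1, hl.2.le⟩)
    (fun l hl => hF.finiteDimensional_ker (Set.Ioo_subset_Icc_self (hmem l hl)))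
    (fun l hl => hF.isUnit (Set.Ioo_subset_Icc_self (hmem l hl))) fun l hl => ?_
  filter_upwards [hF.eventually_ker_eq_bot (hmem l hl),
    nhdsWithin_le_nhds (Icc_mem_nhds (hmem l hl).1 (hmem l hl).2)] with s hs hsI
  exact hF.isUnit hsI hs

theorem ker_neg_schur (t : ℝ) : LinearMap.ker (-M.schur t).toLinearMap =
    LinearMap.ker (M.schur t).toLinearMap := by
  ext x
  exact neg_eq_zero

theorem isPurelyDiscreteOn_of_isEssentiallyPositive_neg {a b : ℝ} (hab : a ≤ b)
    (hu : ∀ l ∈ Set.Icc a b, IsUnit (M.pencil₂ l)) (ha : IsEssentiallyPositive (-M.schur a)) :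
    IsPurelyDiscreteOn M.angularExtension (Set.Ioc a b) := by
  obtain ⟨b', hb', hu'⟩ := M.exists_gt_isUnit_pencil₂ hab hu
  have hF := M.isDecreasingFamily_neg_schur hu' ha
  have hunit : ∀ t : ℝ, -t ∈ Set.Icc (-b') (-a) →
      LinearMap.ker (M.schur t).toLinearMap = ⊥ → IsUnit (M.schur t) := fun t ht h => by
    have h1 := hF.isUnit ht
    simp only [neg_neg, ker_neg_schur, IsUnit.neg_iff] at h1
    exact h1 h
  have hmem : ∀ l ∈ Set.Ioc a b, -l ∈ Set.Ioo (-b') (-a) := fun l hl =>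
    ⟨neg_lt_neg (hl.2.trans_lt hb'), neg_lt_neg hl.1⟩
  refine M.isPurelyDiscreteOn_of_schur (fun l hl => hu l ⟨hl.1.le, hl.2⟩) (fun l hl => ?_)
    (fun l hl => hunit l (Set.Ioo_subset_Icc_self (hmem l hl))) fun l hl => ?_
  · have h := hF.finiteDimensional_ker (Set.Ioo_subset_Icc_self (hmem l hl))
    rw [ker_neg_schur, neg_neg] at h
    exact h
  · have ht : Tendsto (fun s : ℝ => -s) (𝓝[≠] l) (𝓝[≠] (-l)) := by
      refine tendsto_nhdsWithin_iff.2 ⟨(continuous_neg.tendsto l).mono_left nhdsWithin_le_nhds, ?_⟩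
      filter_upwards [self_mem_nhdsWithin] with s hs
      exact fun h => hs (neg_injective h)
    filter_upwards [ht.eventually (hF.eventually_ker_eq_bot (hmem l hl)),
      ht.eventually (nhdsWithin_le_nhds (Icc_mem_nhds (hmem l hl).1 (hmem l hl).2))] with s hs hsI
    rw [neg_neg, ker_neg_schur] at hs
    exact hunit s hsI hs

theorem totalMultiplicity_add_operatorNegIndex {a b : ℝ} (hab : a ≤ b)
    (hu : ∀ l ∈ Set.Icc a b, IsUnit (M.pencil₂ l)) (hb : IsEssentiallyPositive (M.schur b)) :
    totalMultiplicity M.angularExtension (Set.Ico a b) + operatorNegIndex (M.schur a) =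
      operatorNegIndex (M.schur b) := by
  obtain ⟨P, h1, h2, h3⟩ := (M.isDecreasingFamily_schur hu hb).exists_finset_sum_finrank_ker hab
  rw [M.totalMultiplicity_eq_sum_schur (fun l hl => hu l ⟨hl.1, hl.2.le⟩) h1 h2]
  exact h3

theorem totalMultiplicity_add_operatorNegIndex_neg {a b : ℝ} (hab : a ≤ b)
    (hu : ∀ l ∈ Set.Icc a b, IsUnit (M.pencil₂ l)) (ha : IsEssentiallyPositive (-M.schur a)) :
    totalMultiplicity M.angularExtension (Set.Ioc a b) + operatorNegIndex (-M.schur b) =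
      operatorNegIndex (-M.schur a) := by
  obtain ⟨P, h1, h2, h3⟩ := (M.isDecreasingFamily_neg_schur hu ha).exists_finset_sum_finrank_ker
    (neg_le_neg hab)
  have hker : ∀ t : ℝ, Cardinal.toENat (Module.rank ℂ (LinearMap.ker (-M.schur t).toLinearMap)) =
      Cardinal.toENat (Module.rank ℂ (LinearMap.ker (M.schur t).toLinearMap)) := fun t => by
    rw [ker_neg_schur]
  simp only [neg_neg, ker_neg_schur, hker] at h2 h3
  rw [M.totalMultiplicity_eq_sum_schur (P := P.image (fun t => -t))
    (fun l hl => hu l ⟨hl.1.le, hl.2⟩), Finset.sum_image fun s _ t _ h => neg_injective h]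
  · exact h3
  · intro l hl
    obtain ⟨t, ht, rfl⟩ := Finset.mem_image.1 (Finset.mem_coe.1 hl)
    have := h1 ht
    exact ⟨by linarith [this.2], by linarith [this.1]⟩
  · intro l hl hne
    refine Finset.mem_image.2 ⟨-l, h2 (-l) ⟨neg_le_neg hl.2, neg_lt_neg hl.1⟩ ?_, neg_neg l⟩
    rwa [neg_neg]

/-! ### From the compactness hypotheses to the index formulas -/

theorem isEssentiallyPositive_schur {l : ℝ}
    (h : IsCompactPerturbationOf IsUniformlyPositive (M.S l)) :
    IsEssentiallyPositive (M.schur l) := by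
  rw [S_eq] at h
  exact isEssentiallyPositive_of_isCompactPerturbationOf h

theorem isEssentiallyPositive_neg_schur {l : ℝ}
    (h : IsCompactPerturbationOf IsUniformlyNegative (M.S l)) :
    IsEssentiallyPositive (-M.schur l) := by
  obtain ⟨A, K, ⟨ε, hε, hA⟩, hK, hS⟩ := h
  refine isEssentiallyPositive_of_isCompactPerturbationOf ⟨-A, -K, ⟨ε, hε, fun y => ?_⟩, hK.neg, ?_⟩
  · have := hA y
    simp only [neg_apply, Complex.neg_im, Complex.neg_re]
    exact ⟨by rw [this.1, neg_zero], by linarith⟩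
  · rw [ContinuousLinearMap.comp_neg, ← S_eq, hS]
    exact neg_add A K

end BlockMatrix

end

/-- The differences of indices are written as sums in `ℕ∞`. As the right-hand sides are finite, the
formulas also give finiteness of the index at the other endpoint and of the total multiplicity. -/
theorem mainTheorem4 {H₁ H₂ : Type*} [NormedAddCommGroup H₁] [InnerProductSpace ℂ H₁]
    [CompleteSpace H₁] [NormedAddCommGroup H₂] [InnerProductSpace ℂ H₂] [CompleteSpace H₂]
    (M : BlockMatrix H₁ H₂) (ζm ζp : ℝ) (hζ : ζm ≤ ζp)
    (hρ : ∀ l ∈ Set.Icc ζm ζp, (l : ℂ) ∈ opResolventSet M.bullet₂₂) :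
    (IsCompactPerturbationOf IsUniformlyPositive (M.S ζp) →
      IsPurelyDiscreteOn M.angularExtension (Set.Ico ζm ζp) ∧
        negIndex (M.S ζp) ≠ ⊤ ∧
        totalMultiplicity M.angularExtension (Set.Ico ζm ζp) + negIndex (M.S ζm) =
          negIndex (M.S ζp)) ∧
    (IsCompactPerturbationOf IsUniformlyNegative (M.S ζm) →
      IsPurelyDiscreteOn M.angularExtension (Set.Ioc ζm ζp) ∧
        negIndex (-M.S ζm) ≠ ⊤ ∧
        totalMultiplicity M.angularExtension (Set.Ioc ζm ζp) + negIndex (-M.S ζp) =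
          negIndex (-M.S ζm)) := by
  have hu : ∀ l ∈ Set.Icc ζm ζp, IsUnit (M.pencil₂ l) := fun l hl => M.isUnit_pencil₂ (hρ l hl)
  rw [M.negIndex_S, M.negIndex_S, M.negIndex_neg_S, M.negIndex_neg_S]
  refine ⟨fun h => ?_, fun h => ?_⟩
  · have hp := M.isEssentiallyPositive_schur h
    exact ⟨M.isPurelyDiscreteOn_of_isEssentiallyPositive hζ hu hp,
      (M.isDecreasingFamily_schur hu hp).operatorNegIndex_ne_top ⟨hζ, le_rfl⟩,
      M.totalMultiplicity_add_operatorNegIndex hζ hu hp⟩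
  · have hp := M.isEssentiallyPositive_neg_schur h
    have hne := (M.isDecreasingFamily_neg_schur hu hp).operatorNegIndex_ne_top
      ⟨neg_le_neg hζ, le_rfl⟩
    rw [neg_neg] at hne
    exact ⟨M.isPurelyDiscreteOn_of_isEssentiallyPositive_neg hζ hu hp, hne,
      M.totalMultiplicity_add_operatorNegIndex_neg hζ hu hp⟩
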